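/- Let $F$ be a field (of any characteristic, $2$ included), $\overline F$ a separable closure of $F$, and $\Gamma=\operatorname{Gal}(\overline F/F)$. Let $(V,Q)$ be a finite-dimensional quadratic space over $F$ that is nondegenerate, i.e. whose polar form $B(x,y)=Q(x+y)-Q(x)-Q(y)$ is nondegenerate, and let $\varphi:\Gamma\to O(Q)(F)$ be a homomorphism with open kernel. **Notation.** Cohomology is continuous cohomology of $\Gamma$ with discrete coefficients; $\operatorname{Br}(F)=H^2(\Gamma,\overline F^\times)$, $\operatorname{Br}_2(F)=\{x\in \operatorname{Br}(F):2x=0\}$, and $\operatorname{Br}_2(F)_s=\{(\chi,x):\chi\in H^1(\Gamma,\mathbb F_2),\ x\in\operatorname{Br}_2(F)\}$ with the group law $(\chi,x)+(\chi',x')=(\chi+\chi',\,x+x'+\chi\cup\chi')$, where $\cup$ is induced by the pairing $\mathbb F_2\otimes\mathbb F_2\to\overline F^\times$, $m\otimes n\mapsto(-1)^{mn}$. We regard $\operatorname{Br}_2(F)$ as a subgroup of $\operatorname{Br}_2(F)_s$ via $x\mapsto(0,x)$. * *Clifford group.* $Cl(Q)$ is the group of homogeneous units $x$ of the Clifford algebra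 $C(Q)$ such that $\operatorname{Int}_s(x):y\mapsto(-1)^{\deg x\deg y}xyx^{-1}$ maps $V$ onto $V$. There is an exact sequence $1\to\mathbb G_m\to Cl(Q)\xrightarrow{\rho}O(Q)\to1$ with $\rho(x)=\operatorname{Int}_s(x)|_V$; the degree on $Cl(Q)$ induces $\deg:O(Q)\to\mathbb F_2$; and $N:Cl(Q)\to\mathbb G_m$ is $N(x)=x_tx$, where $x\mapsto x_t$ is the anti-involution of $C(Q)$ that is the identity on $V$. The spinor norm $\delta:O(Q)(F)\to F^\times/(F^\times)^2$ sends $g$ to the square class of $N(\dot g)$ for any $\dot g\in Cl(Q)(F)$ with $\rho(\dot g)=g$. * *The map $\xi$.* For $\chi\in H^1(\Gamma,\mathbb F_2)$ and $b\in F^\times$ let $\{\chi,b\}=b\cup\partial\chi\in\operatorname{Br}_2(F)$, where $\partial:H^1(\Gamma,\mathbb F_2)\to H^2(\Gamma,\mathbb Z)$ is the connecting map of $0\to\mathbb Z\xrightarrow{2}\mathbb Z\to\mathbb F_2\to0$. Then $\xi:H^1(\Gamma,F^\times/(F^\times)^2)\cong H^1(\Gamma,\mathbb F_2)\otimes F^\times/(F^\times)^2\to\operatorname{Br}_2(F)$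 is the homomorphism with $\xi(\chi\otimes b)=\{\chi,b\}$. * *Stiefel–Whitney class.* Let $k$ be any algebraically closed field containing $F$ and $\varphi_k:\Gamma\to O(Q)(k)$ the representation obtained from $\varphi$. Put $SW_1(\varphi)=\deg\circ\varphi_k$. If $\operatorname{char}F\ne2$, $SW_2(\varphi)\in H^2(\Gamma,\mathbb F_2)$ is the image of $\varphi_k$ under the connecting map of $1\to\mu_2(k)\to\{x\in Cl(Q)(k):N(x)=1\}\to O(Q)(k)\to1$ (trivial $\Gamma$-actions); if $\operatorname{char}F=2$, $SW_2(\varphi)=0$. Let $\overline{SW}(\varphi)=(SW_1(\varphi),\overline{SW}_2(\varphi))$, where $\overline{SW}_2(\varphi)$ is the image of $SW_2(\varphi)$ under the map $H^2(\Gamma,\mathbb F_2)\to\operatorname{Br}(F)$ induced by $n\mapsto(-1)^n$. * *Relative Hasse–Witt invariant.* If $(V',Q')$ is a quadratic space over $F$ and $u:\overline F\otimes V\to\overline F\otimes V'$ is an isometry, let $a_\sigma=u^{-1}\sigma(u)$, a $1$-cocycle of $\Gamma$ in $O(Q)(\overline F)$. Then $HW(Q',Q)=(\deg_*(a),\partial(a))$,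 where $\partial:H^1(\Gamma,O(Q)(\overline F))\to H^2(\Gamma,\overline F^\times)$ is the connecting map of $1\to\overline F^\times\to Cl(Q)(\overline F)\to O(Q)(\overline F)\to1$; it does not depend on $u$. * *Twist.* $V_\varphi=\{v\in\overline F\otimes_FV:\varphi(\sigma)(\sigma(v))=v\ \text{for all }\sigma\in\Gamma\}$, and $Q_\varphi$ is the restriction to $V_\varphi$ of the extension of $Q$ to $\overline F\otimes_F V$; it takes values in $F$. **Proposition (Fröhlich in characteristic $\neq2$).** The invariants $\delta$, $SW(\varphi)$ and $HW(Q_\varphi,Q)$ are well defined, $\delta\circ\varphi$ is an element of $H^1(\Gamma,F^\times/(F^\times)^2)$, the classes $\overline{SW}(\varphi)$ and $HW(Q_\varphi,Q)$ lie in $\operatorname{Br}_2(F)_s$, and they differ by the element $\xi(\delta\circ\varphi)$ of the subgroup $\operatorname{Br}_2(F)$: $$\overline{SW}(\varphi)-HW(Q_\varphi,Q)=\xi(\delta\circ\varphi)\quad\text{in }\operatorname{Br}_2(F)_s .$$ -/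

import Mathlib

open scoped TensorProduct

namespace FrohlichTheory

noncomputable section

/-! ## Continuous cohomology in degrees one and two

Coefficient groups are discrete, so continuous cochains are the locally constant ones. -/

section Cohomology

variable (G : Type*) [Group G] [TopologicalSpace G] (M : Type*) [AddCommGroup M]

/-- `H¹(G, M)` for the trivial action of `G` on the discrete group `M`: the group of
continuous homomorphisms `G → M`. -/
def H1 : AddSubgroup (G → M) where
  carrier := {f | IsLocallyConstant f ∧ ∀ s t, f (s * t) = f s + f t}
  zero_mem' := ⟨IsLocallyConstant.const 0, by simp⟩
  add_mem' := by
    rintro f g ⟨hf, hf2⟩ ⟨hg, hg2⟩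
    refine ⟨hf.add hg, fun s t => ?_⟩
    simp only [Pi.add_apply, hf2, hg2]; abel
  neg_mem' := by
    rintro f ⟨hf, hf2⟩
    refine ⟨hf.neg, fun s t => ?_⟩
    simp only [Pi.neg_apply, hf2]; abel

variable {G M}

/-- Continuous inhomogeneous `2`-cocycles of `G` in the `G`-module `(M, ρ)`. -/
def Z2 (ρ : G →* AddMonoid.End M) : AddSubgroup (G × G → M) where
  carrier := {z | IsLocallyConstant z ∧
    ∀ r s t, ρ r (z (s, t)) - z (r * s, t) + z (r, s * t) - z (r, s) = 0}
  zero_mem' := ⟨IsLocallyConstant.const 0, by simp⟩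
  add_mem' := by
    rintro f g ⟨hf, hf2⟩ ⟨hg, hg2⟩
    refine ⟨hf.add hg, fun r s t => ?_⟩
    have h := congrArg₂ (· + ·) (hf2 r s t) (hg2 r s t)
    simp only [Pi.add_apply, map_add, add_zero] at h ⊢
    rw [← h]; abel
  neg_mem' := by
    rintro f ⟨hf, hf2⟩
    refine ⟨hf.neg, fun r s t => ?_⟩
    have h := congrArg (- ·) (hf2 r s t)
    simp only [Pi.neg_apply, map_neg, neg_zero] at h ⊢
    rw [← h]; abel

/-- Coboundaries of continuous `1`-cochains. -/
def B2 (ρ : G →* AddMonoid.End M) : AddSubgroup (Z2 ρ) where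
  carrier := {z | ∃ f : G → M, IsLocallyConstant f ∧
    ∀ s t, z.1 (s, t) = ρ s (f t) - f (s * t) + f s}
  zero_mem' := ⟨0, IsLocallyConstant.const 0, by simp⟩
  add_mem' := by
    rintro z w ⟨f, hf, hz⟩ ⟨g, hg, hw⟩
    refine ⟨f + g, hf.add hg, fun s t => ?_⟩
    simp only [AddSubgroup.coe_add, Pi.add_apply, map_add, hz, hw]; abel
  neg_mem' := by
    rintro z ⟨f, hf, hz⟩
    refine ⟨-f, hf.neg, fun s t => ?_⟩
    simp only [AddSubgroup.coe_neg, Pi.neg_apply, map_neg, hz]; abel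

/-- `H²(G, M)`: continuous cohomology with coefficients in the discrete module `(M, ρ)`. -/
def H2 (ρ : G →* AddMonoid.End M) : Type _ := Z2 ρ ⧸ B2 ρ

instance (ρ : G →* AddMonoid.End M) : AddCommGroup (H2 ρ) :=
  inferInstanceAs (AddCommGroup (Z2 ρ ⧸ B2 ρ))

/-- The class of a `2`-cocycle. -/
def H2.mk {ρ : G →* AddMonoid.End M} : Z2 ρ →+ H2 ρ := QuotientAddGroup.mk' (B2 ρ)

theorem H2.mk_surjective {ρ : G →* AddMonoid.End M} :
    Function.Surjective (H2.mk : Z2 ρ →+ H2 ρ) :=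
  QuotientAddGroup.mk_surjective

theorem H2.mk_eq_zero {ρ : G →* AddMonoid.End M} {z : Z2 ρ} (f : G → M)
    (hf : IsLocallyConstant f) (h : ∀ s t, z.1 (s, t) = ρ s (f t) - f (s * t) + f s) :
    H2.mk z = 0 :=
  (QuotientAddGroup.eq_zero_iff z).2 ⟨f, hf, h⟩

variable {N : Type*} [AddCommGroup N]

/-- The map on `H²` induced by a homomorphism of `G`-modules. -/
def H2.map {ρ : G →* AddMonoid.End M} {ρ' : G →* AddMonoid.End N} (f : M →+ N)
    (hf : ∀ g m, f (ρ g m) = ρ' g (f m)) : H2 ρ →+ H2 ρ' :=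
  QuotientAddGroup.map (B2 ρ) (B2 ρ')
    { toFun := fun z => ⟨fun p => f (z.1 p), z.2.1.comp f, fun r s t => by
        rw [← hf, ← map_sub, ← map_add, ← map_sub, z.2.2, map_zero]⟩
      map_zero' := by ext; simp
      map_add' := fun z w => by ext; simp }
    (by
      rintro z ⟨g, hg, hz⟩
      refine ⟨fun s => f (g s), hg.comp f, fun s t => ?_⟩
      simp only [AddMonoidHom.coe_mk, ZeroHom.coe_mk, hz, map_add, map_sub, hf])

/-- The carry `(a + b - (a + b mod 2)) / 2` of `a, b ∈ {0, 1}`. -/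
def carry (a b : ZMod 2) : ℤ := ((a.val : ℤ) + b.val - (a + b).val) / 2

/-- The connecting homomorphism `H¹(G, 𝔽₂) → H²(G, ℤ)` of `0 → ℤ → ℤ → 𝔽₂ → 0` (multiplication
by `2`), computed with the lifting of `𝔽₂` to `{0, 1}`: with `c` the lift of `χ`, it is the class
of `(s, t) ↦ (c s + c t - c (s t)) / 2`. -/
def bockstein : H1 G (ZMod 2) →+ H2 (1 : G →* AddMonoid.End ℤ) where
  toFun χ := H2.mk ⟨fun p => carry (χ.1 p.1) (χ.1 p.2),
    ((χ.2.1.comp_continuous continuous_fst).prodMk (χ.2.1.comp_continuous continuous_snd)).comp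
      (fun q : ZMod 2 × ZMod 2 => carry q.1 q.2), fun r s t => by
      have key : ∀ a b c : ZMod 2,
        carry b c - carry (a + b) c + carry a (b + c) - carry a b = 0 := by decide
      simpa [χ.2.2] using key (χ.1 r) (χ.1 s) (χ.1 t)⟩
  map_zero' := by
    refine H2.mk_eq_zero 0 (IsLocallyConstant.const 0) fun s t => ?_
    have : carry 0 0 = 0 := by decide
    simpa using this
  map_add' χ ψ := by
    rw [← sub_eq_zero, ← map_add, ← map_sub]
    refine H2.mk_eq_zero (fun s => - carry (χ.1 s) (ψ.1 s))
      ((χ.2.1.prodMk ψ.2.1).comp (fun q : ZMod 2 × ZMod 2 => - carry q.1 q.2)) fun s t => ?_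
    have key : ∀ a b c d : ZMod 2, carry (a + c) (b + d) - (carry a b + carry c d) =
      - carry b d - - carry (a + b) (c + d) + - carry a c := by decide
    simpa [χ.2.2, ψ.2.2] using key (χ.1 s) (χ.1 t) (ψ.1 s) (ψ.1 t)

/-- The cup product `H¹(G, 𝔽₂) × H¹(G, 𝔽₂) → H²(G, 𝔽₂)`. -/
def cup : H1 G (ZMod 2) →+ H1 G (ZMod 2) →+ H2 (1 : G →* AddMonoid.End (ZMod 2)) :=
  AddMonoidHom.mk' (fun χ => AddMonoidHom.mk' (fun ψ =>
    H2.mk ⟨fun p => χ.1 p.1 * ψ.1 p.2,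
      (χ.2.1.comp_continuous continuous_fst).mul (ψ.2.1.comp_continuous continuous_snd),
      fun r s t => by
        simp only [MonoidHom.one_apply, AddMonoid.End.coe_one, id_eq, χ.2.2, ψ.2.2]; ring⟩)
    (fun ψ ψ' => by
      rw [← map_add]; congr 1; ext p; simp [mul_add]))
    (fun χ χ' => by
      ext ψ
      simp only [AddMonoidHom.mk'_apply, AddMonoidHom.add_apply]
      rw [← map_add]; congr 1; ext p; simp [add_mul])

theorem cup_comm (χ ψ : H1 G (ZMod 2)) : cup χ ψ = cup ψ χ := by
  rw [← sub_eq_zero]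
  simp only [cup, AddMonoidHom.mk'_apply]
  rw [← map_sub]
  refine H2.mk_eq_zero (fun s => χ.1 s * ψ.1 s) (χ.2.1.mul ψ.2.1) fun s t => ?_
  have key : ∀ a b c d : ZMod 2, a * d - c * b = b * d - (a + b) * (c + d) + a * c := by decide
  simpa [χ.2.2, ψ.2.2] using key (χ.1 s) (χ.1 t) (ψ.1 s) (ψ.1 t)

theorem two_nsmul_zmod (a : ZMod 2) : 2 • a = 0 := by revert a; decide

theorem two_nsmul_H1 (χ : H1 G (ZMod 2)) : 2 • χ = 0 := by
  ext s
  exact two_nsmul_zmod (χ.1 s)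

theorem two_nsmul_cup (χ ψ : H1 G (ZMod 2)) : 2 • cup χ ψ = 0 := by
  rw [← AddMonoidHom.nsmul_apply, ← map_nsmul, two_nsmul_H1, map_zero, AddMonoidHom.zero_apply]

end Cohomology

/-! ## The isomorphism `H¹(G, 𝔽₂) ⊗ U ≅ H¹(G, U)` -/

section CupIso

variable (G : Type*) [Group G] [TopologicalSpace G] {U : Type*} [AddCommGroup U]
  (hU : ∀ u : U, 2 • u = 0)

theorem val_add_nsmul (hU : ∀ u : U, 2 • u = 0) (a b : ZMod 2) (u : U) :
    (a + b).val • u = a.val • u + b.val • u := by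
  have key : ∀ a b : ZMod 2, (a + b).val = a.val + b.val ∨ (a + b).val + 2 = a.val + b.val := by
    decide
  rcases key a b with h | h
  · rw [h, add_nsmul]
  · rw [← add_nsmul, ← h, add_nsmul, hU, add_zero]

/-- The pairing `H¹(G, 𝔽₂) × U → H¹(G, U)`, `(χ, u) ↦ (s ↦ χ(s) u)`, for a group `U` killed by
`2` with trivial `G`-action. -/
def mulU (χ : H1 G (ZMod 2)) (u : U) : H1 G U :=
  ⟨fun s => (χ.1 s).val • u, χ.2.1.comp (fun a : ZMod 2 => a.val • u), fun s t => by
    simp only [χ.2.2, val_add_nsmul hU]⟩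

/-- The biadditive version of `mulU`. -/
def mulUHom : H1 G (ZMod 2) →+ U →+ H1 G U :=
  AddMonoidHom.mk' (fun χ => AddMonoidHom.mk' (fun u => mulU G hU χ u)
      (fun u v => Subtype.ext (funext fun _ => nsmul_add u v _)))
    (fun χ ψ => AddMonoidHom.ext fun u => Subtype.ext (funext fun s =>
      val_add_nsmul hU (χ.1 s) (ψ.1 s) u))

/-- The homomorphism `H¹(G, 𝔽₂) ⊗ U → H¹(G, U)`, `χ ⊗ u ↦ (s ↦ χ(s) u)`. -/
def cupU : H1 G (ZMod 2) ⊗[ℤ] U →+ H1 G U :=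
  TensorProduct.liftAddHom (mulUHom G hU) (fun r χ u => by
    rw [map_zsmul, AddMonoidHom.zsmul_apply, map_zsmul])

theorem cupU_tmul (χ : H1 G (ZMod 2)) (u : U) (s : G) :
    (cupU G hU (χ ⊗ₜ u)).1 s = (χ.1 s).val • u := by
  rfl

theorem cupU_bijective [CompactSpace G] : Function.Bijective (cupU G hU) := by
  classical
  let _ : Module (ZMod 2) U := AddCommGroup.zmodModule hU
  have hval : ∀ (a : ZMod 2) (u : U), a.val • u = a • u := fun a u => by
    rw [← Nat.cast_smul_eq_nsmul (ZMod 2), ZMod.natCast_zmod_val]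
  let B := Module.Basis.ofVectorSpace (ZMod 2) U
  constructor
  · rw [injective_iff_map_eq_zero]
    intro t ht
    obtain ⟨f, hf⟩ : ∃ f : Module.Basis.ofVectorSpaceIndex (ZMod 2) U →₀ H1 G (ZMod 2),
        t = f.sum fun i χ => χ ⊗ₜ[ℤ] B i := by
      clear ht
      induction t using TensorProduct.induction_on with
      | zero => exact ⟨0, by simp⟩
      | add x y hx hy =>
        obtain ⟨f, rfl⟩ := hx
        obtain ⟨g, rfl⟩ := hy
        refine ⟨f + g, ?_⟩
        rw [Finsupp.sum_add_index']
        · intro i; simp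
        · intro i χ ψ; rw [TensorProduct.add_tmul]
      | tmul χ u =>
        refine ⟨(B.repr u).mapRange (fun c => c.val • χ) (by simp), ?_⟩
        rw [Finsupp.sum_mapRange_index (by simp)]
        conv_lhs => rw [← B.linearCombination_repr u, Finsupp.linearCombination_apply,
          Finsupp.sum, TensorProduct.tmul_sum]
        refine Finset.sum_congr rfl fun i _ => ?_
        rw [← hval]
        simp [TensorProduct.tmul_smul, TensorProduct.smul_tmul']
    have hz : ∀ i s, (f i).1 s = 0 := by
      intro i s
      have h1 : (cupU G hU t).1 s = 0 := by rw [ht]; rfl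
      have h2 : (cupU G hU t).1 s = f.sum fun i χ => χ.1 s • B i := by
        rw [hf, Finsupp.sum, map_sum, Finsupp.sum]
        have : ∀ x : H1 G U, x.1 s = ((Pi.evalAddMonoidHom (fun _ : G => U) s).comp
          (H1 G U).subtype) x := fun _ => rfl
        rw [this, map_sum]
        refine Finset.sum_congr rfl fun i _ => ?_
        rw [← this, cupU_tmul, hval]
      rw [h1] at h2
      by_cases hi : i ∈ f.support
      · exact linearIndependent_iff'.1 B.linearIndependent f.support (fun i => (f i).1 s)
          h2.symm i hi
      · rw [Finsupp.notMem_support_iff.1 hi]; rfl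
    have : f = 0 := by
      ext i s
      exact hz i s
    rw [hf, this, Finsupp.sum_zero_index]
  · intro η
    have hfin : (Set.range η.1).Finite := η.2.1.range_finite
    let S := hfin.toFinset.biUnion fun u => (B.repr u).support
    let ψ : Module.Basis.ofVectorSpaceIndex (ZMod 2) U → H1 G (ZMod 2) := fun i =>
      ⟨fun s => B.repr (η.1 s) i, η.2.1.comp (fun u => B.repr u i), fun s t => by
        simp only [η.2.2, map_add, Finsupp.add_apply]⟩
    refine ⟨∑ i ∈ S, ψ i ⊗ₜ B i, ?_⟩
    ext s
    have : ∀ x : H1 G U, x.1 s = ((Pi.evalAddMonoidHom (fun _ : G => U) s).comp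
      (H1 G U).subtype) x := fun _ => rfl
    rw [this, map_sum, map_sum]
    have h2 : η.1 s = ∑ i ∈ S, B.repr (η.1 s) i • B i := by
      conv_lhs => rw [← B.linearCombination_repr (η.1 s), Finsupp.linearCombination_apply]
      refine Finsupp.sum_of_support_subset _ ?_ _ (by simp)
      intro i hi
      exact Finset.mem_biUnion.2 ⟨η.1 s, by simp, hi⟩
    rw [h2]
    refine Finset.sum_congr rfl fun i _ => ?_
    rw [← this, cupU_tmul, hval]

/-- The isomorphism `H¹(G, 𝔽₂) ⊗ U ≅ H¹(G, U)` for a profinite (or just compact) group `G`. -/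
def cupUEquiv [CompactSpace G] : H1 G (ZMod 2) ⊗[ℤ] U ≃+ H1 G U :=
  AddEquiv.ofBijective (cupU G hU) (cupU_bijective G hU)

end CupIso

/-! ## The Brauer group and the pairing with square classes -/

section Brauer

variable (F : Type*) [Field F] (Fs : Type*) [Field Fs] [Algebra F Fs]

/-- The action of `Γ = Gal(Fs/F)` on `Fsˣ`, written additively. -/
def galUnits : Gal(Fs/F) →* AddMonoid.End (Additive Fsˣ) where
  toFun σ := MonoidHom.toAdditive (Units.map (σ : Fs →* Fs))
  map_one' := rfl
  map_mul' _ _ := rfl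

/-- The Brauer group `Br(F) = H²(Γ, Fsˣ)`, for `Fs` a separable closure of `F`. -/
abbrev Br : Type _ := H2 (galUnits F Fs)

/-- `Br₂(F)`, the subgroup of elements killed by `2`. -/
def Br2 : AddSubgroup (Br F Fs) where
  carrier := {x | 2 • x = 0}
  zero_mem' := nsmul_zero 2
  add_mem' := fun {x y} (hx : 2 • x = 0) (hy : 2 • y = 0) =>
    show 2 • (x + y) = 0 by rw [nsmul_add, hx, hy, add_zero]
  neg_mem' := fun {x} (hx : 2 • x = 0) =>
    show 2 • (-x) = 0 by rw [neg_nsmul, hx, neg_zero]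

/-- The group `Fˣ/(Fˣ)²`, written additively. -/
def SqClass : Type _ := Additive Fˣ ⧸ (nsmulAddMonoidHom (α := Additive Fˣ) 2).range

instance : AddCommGroup (SqClass F) :=
  inferInstanceAs (AddCommGroup (Additive Fˣ ⧸ (nsmulAddMonoidHom (α := Additive Fˣ) 2).range))

variable {F} in
/-- The square class of a unit. -/
def SqClass.mk : Additive Fˣ →+ SqClass F := QuotientAddGroup.mk' _

theorem SqClass.two_nsmul (u : SqClass F) : 2 • u = 0 := by
  obtain ⟨x, rfl⟩ := QuotientAddGroup.mk_surjective u
  exact (QuotientAddGroup.eq_zero_iff _).2 ⟨x, rfl⟩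

variable {F}

/-- For `b ∈ Fˣ = H⁰(Γ, Fsˣ)`, the cup product `x ↦ b ∪ x` from `H²(Γ, ℤ)` to `Br(F)`: it is
induced by the homomorphism `n ↦ bⁿ` of `Γ`-modules `ℤ → Fsˣ`. -/
def unitCup (b : Additive Fˣ) : H2 (1 : Gal(Fs/F) →* AddMonoid.End ℤ) →+ Br F Fs :=
  H2.map (zmultiplesHom (Additive Fsˣ)
      (Additive.ofMul (Units.map (algebraMap F Fs : F →* Fs) b.toMul)))
    (fun g m => by
      have h : galUnits F Fs g (Additive.ofMul (Units.map (algebraMap F Fs : F →* Fs) b.toMul)) =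
          Additive.ofMul (Units.map (algebraMap F Fs : F →* Fs) b.toMul) := by
        apply Additive.toMul.injective
        ext
        exact g.commutes _
      simp only [MonoidHom.one_apply, AddMonoid.End.coe_one, id_eq, zmultiplesHom_apply,
        map_zsmul, h])

theorem unitCup_add (b c : Additive Fˣ) (x : H2 (1 : Gal(Fs/F) →* AddMonoid.End ℤ)) :
    unitCup Fs (b + c) x = unitCup Fs b x + unitCup Fs c x := by
  obtain ⟨z, rfl⟩ := H2.mk_surjective x
  change H2.mk _ = H2.mk _ + H2.mk _
  rw [← map_add]
  congr 1
  ext p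
  simp [zsmul_add]

/-- The local symbol `{χ, b} = b ∪ δχ ∈ Br(F)`, with `δ : H¹(Γ, 𝔽₂) → H²(Γ, ℤ)` the connecting
homomorphism; it depends on `b ∈ Fˣ` only modulo squares. -/
def symbolHom (χ : H1 Gal(Fs/F) (ZMod 2)) : SqClass F →+ Br F Fs :=
  QuotientAddGroup.lift _
    (AddMonoidHom.mk' (fun b => unitCup Fs b (bockstein χ)) fun b c => unitCup_add Fs b c _)
    (by
      rintro _ ⟨b, rfl⟩
      rw [nsmulAddMonoidHom_apply]
      refine (map_nsmul _ 2 b).trans ?_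
      rw [AddMonoidHom.mk'_apply, ← map_nsmul, ← map_nsmul, two_nsmul_H1, map_zero, map_zero])

theorem symbolHom_mk (χ : H1 Gal(Fs/F) (ZMod 2)) (b : Additive Fˣ) :
    symbolHom Fs χ (SqClass.mk b) = unitCup Fs b (bockstein χ) := rfl

/-- The local symbol as a biadditive map. -/
def symbol : H1 Gal(Fs/F) (ZMod 2) →+ SqClass F →+ Br F Fs :=
  AddMonoidHom.mk' (symbolHom Fs) (fun χ ψ => by
    ext b
    obtain ⟨b, rfl⟩ := QuotientAddGroup.mk_surjective b
    change symbolHom Fs (χ + ψ) (SqClass.mk b) =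
      symbolHom Fs χ (SqClass.mk b) + symbolHom Fs ψ (SqClass.mk b)
    simp only [symbolHom_mk, map_add])

/-- The pairing `H¹(Γ, 𝔽₂) ⊗ Fˣ/(Fˣ)² → Br₂(F)` given by the local symbol. -/
def pairing : H1 Gal(Fs/F) (ZMod 2) ⊗[ℤ] SqClass F →+ Br2 F Fs :=
  AddMonoidHom.codRestrict
    (TensorProduct.liftAddHom (symbol Fs) fun r χ u => by
      rw [map_zsmul, AddMonoidHom.zsmul_apply, map_zsmul])
    (Br2 F Fs) (fun t => by
      change 2 • (TensorProduct.liftAddHom (symbol Fs) _) t = 0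
      rw [← map_nsmul]
      have : 2 • t = 0 := by
        induction t using TensorProduct.induction_on with
        | zero => simp
        | add x y hx hy => rw [nsmul_add, hx, hy, add_zero]
        | tmul χ u => rw [TensorProduct.smul_tmul', two_nsmul_H1, TensorProduct.zero_tmul]
      rw [this, map_zero])

/-- `ξ : H¹(Γ, Fˣ/(Fˣ)²) → Br₂(F)`, the local symbol pairing transported through the isomorphism
`H¹(Γ, 𝔽₂) ⊗ Fˣ/(Fˣ)² ≅ H¹(Γ, Fˣ/(Fˣ)²)`. -/
def xi [IsSepClosure F Fs] : H1 Gal(Fs/F) (SqClass F) →+ Br2 F Fs :=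
  haveI : IsGalois F Fs := IsSepClosure.isGalois
  (pairing Fs).comp
    (cupUEquiv Gal(Fs/F) (SqClass.two_nsmul F)).symm.toAddMonoidHom

/-- The homomorphism `𝔽₂ → Kˣ`, `n ↦ (-1)ⁿ` (trivial in characteristic `2`). -/
def sgn (K : Type*) [Field K] : ZMod 2 →+ Additive Kˣ :=
  ZMod.lift 2 ⟨zmultiplesHom (Additive Kˣ) (Additive.ofMul (-1)), by
    rw [zmultiplesHom_apply]
    apply Additive.toMul.injective
    simp⟩

theorem sgn_one (K : Type*) [Field K] : sgn K 1 = Additive.ofMul (-1) := by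
  have h := ZMod.lift_coe 2 (⟨zmultiplesHom (Additive Kˣ) (Additive.ofMul (-1)), by
    rw [zmultiplesHom_apply]
    apply Additive.toMul.injective
    simp⟩ : { f : ℤ →+ Additive Kˣ // f (2 : ℕ) = 0 }) 1
  rw [Int.cast_one] at h
  exact h.trans (one_zsmul _)

variable (F) in
/-- The map `H²(Γ, 𝔽₂) → H²(Γ, Fsˣ) = Br(F)` induced by `n ↦ (-1)ⁿ`. -/
def toBr : H2 (1 : Gal(Fs/F) →* AddMonoid.End (ZMod 2)) →+ Br F Fs :=
  H2.map (sgn Fs) (fun g m => by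
    have key : ∀ a : ZMod 2, a = 0 ∨ a = 1 := by decide
    have h1 : sgn Fs 1 = Additive.ofMul (-1) := sgn_one Fs
    simp only [MonoidHom.one_apply, AddMonoid.End.coe_one, id_eq]
    rcases key m with rfl | rfl
    · simp
    · rw [h1]
      apply Additive.toMul.injective
      ext
      exact (show g (-1 : Fs) = -1 by simp).symm)

/-! ## The little graded Brauer group -/

variable (F) in
/-- The little graded Brauer group: the set of pairs `(χ, x)` with `χ ∈ H¹(Γ, 𝔽₂)` and
`x ∈ Br(F)`, with the group law `(χ, x) + (χ', x') = (χ + χ', x + x' + χ ∪ χ')`. -/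
@[ext]
structure BrS where
  /-- the first component, a continuous sign character of `Γ` -/
  fst : H1 Gal(Fs/F) (ZMod 2)
  /-- the second component, a Brauer class -/
  snd : Br F Fs

namespace BrS

variable {Fs}

instance : Add (BrS F Fs) :=
  ⟨fun a b => ⟨a.fst + b.fst, a.snd + b.snd + toBr F Fs (cup a.fst b.fst)⟩⟩

instance : Zero (BrS F Fs) := ⟨⟨0, 0⟩⟩

instance : Neg (BrS F Fs) := ⟨fun a => ⟨-a.fst, -a.snd + toBr F Fs (cup a.fst a.fst)⟩⟩

theorem fst_add (a b : BrS F Fs) : (a + b).fst = a.fst + b.fst := rfl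

theorem snd_add (a b : BrS F Fs) :
    (a + b).snd = a.snd + b.snd + toBr F Fs (cup a.fst b.fst) := rfl

instance : AddCommGroup (BrS F Fs) where
  add_assoc a b c := by
    ext1
    · exact add_assoc _ _ _
    · simp only [fst_add, snd_add, map_add, AddMonoidHom.add_apply]; abel
  zero_add a := by
    ext1
    · exact zero_add _
    · change 0 + a.snd + toBr F Fs (cup 0 a.fst) = a.snd
      simp
  add_zero a := by
    ext1
    · exact add_zero _
    · change a.snd + 0 + toBr F Fs (cup a.fst 0) = a.snd
      simp
  nsmul := nsmulRec
  zsmul := zsmulRec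
  neg_add_cancel a := by
    ext1
    · exact neg_add_cancel _
    · change (-a.snd + toBr F Fs (cup a.fst a.fst)) + a.snd + toBr F Fs (cup (-a.fst) a.fst) = 0
      rw [map_neg, AddMonoidHom.neg_apply, map_neg]
      abel
  add_comm a b := by
    ext1
    · exact add_comm _ _
    · simp only [snd_add, cup_comm b.fst a.fst]; abel

/-- The subgroup `Br₂(F)_s` of pairs `(χ, x)` with `2x = 0`. -/
def two : AddSubgroup (BrS F Fs) where
  carrier := {a | a.snd ∈ Br2 F Fs}
  zero_mem' := (Br2 F Fs).zero_mem
  add_mem' := fun {a b} ha hb => (Br2 F Fs).add_mem ((Br2 F Fs).add_mem ha hb) (by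
    change 2 • toBr F Fs _ = 0
    rw [← map_nsmul, two_nsmul_cup, map_zero])
  neg_mem' := fun {a} ha => (Br2 F Fs).add_mem ((Br2 F Fs).neg_mem ha) (by
    change 2 • toBr F Fs _ = 0
    rw [← map_nsmul, two_nsmul_cup, map_zero])

/-- The inclusion `Br(F) → Br_s(F)`, `x ↦ (0, x)`. -/
def ofBr : Br F Fs →+ BrS F Fs where
  toFun x := ⟨0, x⟩
  map_zero' := rfl
  map_add' x y := by
    ext1
    · exact (add_zero _).symm
    · change x + y = x + y + toBr F Fs (cup 0 0)
      simp

end BrS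

end Brauer

/-! ## Quadratic forms, orthogonal groups and Clifford groups -/

section Quadratic

variable {F : Type*} [Field F] {V : Type*} [AddCommGroup V] [Module F V]
variable (A : Type*) [CommRing A] [Algebra F A]

/-- The extension of scalars of a quadratic form, in arbitrary characteristic: if `β` is a bilinear
form with `Q(v) = β(v, v)`, it is the quadratic form of the base change of `β`. It is the unique
quadratic form on `A ⊗ V` with `1 ⊗ v ↦ Q(v)`, see `baseChange_one_tmul` and `baseChange_unique`. -/
def baseChange (Q : QuadraticForm F V) : QuadraticForm A (A ⊗[F] V) :=
  LinearMap.BilinMap.toQuadraticMap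
    (LinearMap.BilinForm.baseChange A (LinearMap.BilinMap.toQuadraticMap_surjective Q).choose)

theorem baseChange_one_tmul (Q : QuadraticForm F V) (v : V) :
    baseChange A Q (1 ⊗ₜ v) = algebraMap F A (Q v) := by
  conv_rhs => rw [← (LinearMap.BilinMap.toQuadraticMap_surjective Q).choose_spec]
  change LinearMap.BilinForm.baseChange A _ (1 ⊗ₜ v) (1 ⊗ₜ v) = _
  rw [LinearMap.BilinForm.baseChange_tmul, mul_one, Algebra.algebraMap_eq_smul_one]
  rfl

theorem baseChange_unique (Q : QuadraticForm F V) (q : QuadraticForm A (A ⊗[F] V))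
    (h : ∀ v, q (1 ⊗ₜ v) = algebraMap F A (Q v)) : q = baseChange A Q :=
  _root_.baseChange_ext fun v => by rw [h, baseChange_one_tmul]

/-- The orthogonal group `O(q)` of a quadratic form. -/
def orthogonalGroup {K W : Type*} [CommRing K] [AddCommGroup W] [Module K W]
    (q : QuadraticForm K W) : Subgroup (W ≃ₗ[K] W) where
  carrier := {g | ∀ w, q (g w) = q w}
  one_mem' _ := rfl
  mul_mem' := fun {g h} hg hh w => (hg (h w)).trans (hh w)
  inv_mem' := fun {g} hg w => by
    have := hg (g⁻¹ w)
    rwa [show g (g⁻¹ w) = w from g.apply_symm_apply w, eq_comm] at this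

/-- The extension of scalars `O(Q)(F) → O(Q)(A)`, `g ↦ id ⊗ g`. -/
def orthogonalBaseChange (Q : QuadraticForm F V) :
    orthogonalGroup Q →* orthogonalGroup (baseChange A Q) where
  toFun g := ⟨TensorProduct.AlgebraTensorModule.congr (LinearEquiv.refl A A) g.1, fun w => by
    have h : (baseChange A Q).comp
        (TensorProduct.AlgebraTensorModule.congr (LinearEquiv.refl A A) g.1).toLinearMap =
          baseChange A Q := by
      refine baseChange_unique A Q _ fun v => ?_
      rw [QuadraticMap.comp_apply]
      change baseChange A Q (1 ⊗ₜ g.1 v) = _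
      rw [baseChange_one_tmul, g.2]
    exact congrArg (fun q => q w) h⟩
  map_one' := by
    apply Subtype.ext
    apply LinearEquiv.toLinearMap_injective
    ext v
    rfl
  map_mul' g h := by
    apply Subtype.ext
    apply LinearEquiv.toLinearMap_injective
    ext v
    rfl

end Quadratic

section Clifford

variable {K : Type*} [CommRing K] {W : Type*} [AddCommGroup W] [Module K W]
  (q : QuadraticForm K W)

variable {q} in
/-- For a homogeneous unit `x` of the Clifford algebra and `y` of odd degree, `gradedConj x y` is
`Int_s(x)(y) = (-1)^(deg x deg y) x y x⁻¹ = (-1)^(deg x) x y x⁻¹`. -/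
def gradedConj (x : (CliffordAlgebra q)ˣ) (y : CliffordAlgebra q) : CliffordAlgebra q :=
  CliffordAlgebra.involute (x : CliffordAlgebra q) * y * (x⁻¹ : (CliffordAlgebra q)ˣ)

variable {q} in
theorem gradedConj_mul (x y : (CliffordAlgebra q)ˣ) (a : CliffordAlgebra q) :
    gradedConj (x * y) a = gradedConj x (gradedConj y a) := by
  simp only [gradedConj, Units.val_mul, mul_inv_rev, map_mul, mul_assoc]

variable {q} in
theorem gradedConj_one (a : CliffordAlgebra q) : gradedConj 1 a = a := by
  simp [gradedConj]

variable {q} in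
theorem inv_mem_evenOdd {x : (CliffordAlgebra q)ˣ} {i : ZMod 2}
    (hx : (x : CliffordAlgebra q) ∈ CliffordAlgebra.evenOdd q i) :
    ((x⁻¹ : (CliffordAlgebra q)ˣ) : CliffordAlgebra q) ∈ CliffordAlgebra.evenOdd q i := by
  set y : CliffordAlgebra q := ((x⁻¹ : (CliffordAlgebra q)ˣ) : CliffordAlgebra q) with hy
  have hmul : ∀ {j k a b}, a ∈ CliffordAlgebra.evenOdd q j → b ∈ CliffordAlgebra.evenOdd q k →
      a * b ∈ CliffordAlgebra.evenOdd q (j + k) := fun ha hb =>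
    CliffordAlgebra.evenOdd_mul_le q _ _ (Submodule.mul_mem_mul ha hb)
  have hc : IsCompl (CliffordAlgebra.evenOdd q i) (CliffordAlgebra.evenOdd q (i + 1)) := by
    have h2 : ∀ i : ZMod 2, i = 0 ∨ i = 1 := by decide
    rcases h2 i with rfl | rfl
    · exact (CliffordAlgebra.evenOdd_isCompl q)
    · exact (CliffordAlgebra.evenOdd_isCompl q).symm
  obtain ⟨a, ha, b, hb, hab⟩ := Submodule.mem_sup.1 (hc.sup_eq_top ▸ Submodule.mem_top (x := y))
  have hxy : (x : CliffordAlgebra q) * y = 1 := x.mul_inv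
  have key0 : ∀ i : ZMod 2, i + i = 0 := by decide
  have key1 : ∀ i : ZMod 2, i + (i + 1) = 1 := by decide
  have h0 : (x : CliffordAlgebra q) * a ∈ CliffordAlgebra.evenOdd q 0 := by
    have := hmul hx ha
    rwa [show i + i = 0 from key0 i] at this
  have h1 : (x : CliffordAlgebra q) * b ∈ CliffordAlgebra.evenOdd q 1 := by
    have := hmul hx hb
    rwa [show i + (i + 1) = 1 from key1 i] at this
  have h1' : (x : CliffordAlgebra q) * b ∈ CliffordAlgebra.evenOdd q 0 := by
    have : (x : CliffordAlgebra q) * b = 1 - x * a := by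
      rw [← hxy, ← hab]; noncomm_ring
    rw [this]
    exact Submodule.sub_mem _ (CliffordAlgebra.one_le_evenOdd_zero q (Submodule.one_le.1 le_rfl)) h0
  have h3 : (x : CliffordAlgebra q) * b = 0 :=
    (Submodule.disjoint_def.1 (CliffordAlgebra.evenOdd_isCompl q).disjoint) _ h1' h1
  have h4 : b = 0 := by
    rwa [Units.mul_right_eq_zero] at h3
  rw [← hab, h4, add_zero]
  exact ha

/-- The Clifford group `Cl(q)`: the homogeneous units `x` of the Clifford algebra of `(W, q)` such
that `Int_s(x)` maps `W` onto itself. -/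
def cliffordGroup : Subgroup (CliffordAlgebra q)ˣ where
  carrier := {x | (∃ i, (x : CliffordAlgebra q) ∈ CliffordAlgebra.evenOdd q i) ∧
    gradedConj x '' Set.range (CliffordAlgebra.ι q) = Set.range (CliffordAlgebra.ι q)}
  one_mem' := ⟨⟨0, CliffordAlgebra.one_le_evenOdd_zero q (Submodule.one_le.1 le_rfl)⟩, by
    simp [funext (gradedConj_one (q := q))]⟩
  mul_mem' := by
    rintro x y ⟨⟨i, hi⟩, hx⟩ ⟨⟨j, hj⟩, hy⟩
    refine ⟨⟨i + j, CliffordAlgebra.evenOdd_mul_le q _ _ (Submodule.mul_mem_mul hi hj)⟩, ?_⟩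
    have : gradedConj (x * y) = gradedConj x ∘ gradedConj y := funext (gradedConj_mul x y)
    rw [this, Set.image_comp, hy, hx]
  inv_mem' := by
    rintro x ⟨⟨i, hi⟩, hx⟩
    refine ⟨⟨i, inv_mem_evenOdd hi⟩, ?_⟩
    conv_lhs => rw [← hx]
    rw [← Set.image_comp]
    have : gradedConj x⁻¹ ∘ gradedConj x = id := funext fun a => by
      rw [Function.comp_apply, ← gradedConj_mul, inv_mul_cancel, gradedConj_one]; rfl
    rw [this, Set.image_id]

/-- `IsLift q x g` says that `ρ(x) = g`, where `ρ : Cl(q) → O(q)` sends `x` to the restriction of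
`Int_s(x)` to `W`. -/
def IsLift (x : cliffordGroup q) (g : orthogonalGroup q) : Prop :=
  ∀ w, gradedConj x.1 (CliffordAlgebra.ι q w) = CliffordAlgebra.ι q (g.1 w)

/-- `N(x) = x_t x`, where `x ↦ x_t` is the anti-involution of the Clifford algebra which is the
identity on `W`. -/
def cliffordNorm (x : cliffordGroup q) : CliffordAlgebra q :=
  CliffordAlgebra.reverse (x.1 : CliffordAlgebra q) * (x.1 : CliffordAlgebra q)

/-- `IsDegree q g i` says that `deg(g) = i`, where the degree homomorphism `deg : O(q) → 𝔽₂` is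
induced by the degree on `Cl(q)`. -/
def IsDegree (g : orthogonalGroup q) (i : ZMod 2) : Prop :=
  ∃ x : cliffordGroup q, IsLift q x g ∧ (x.1 : CliffordAlgebra q) ∈ CliffordAlgebra.evenOdd q i

end Clifford

section SpinorNorm

variable {F : Type*} [Field F] {V : Type*} [AddCommGroup V] [Module F V] (Q : QuadraticForm F V)

/-- `IsSpinorNorm Q g c` says that `c` is the square class of `N(x)` for some `x ∈ Cl(Q)` with
`ρ(x) = g`. -/
def IsSpinorNorm (g : orthogonalGroup Q) (c : SqClass F) : Prop :=
  ∃ (x : cliffordGroup Q) (a : Fˣ), IsLift Q x g ∧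
    cliffordNorm Q x = algebraMap F (CliffordAlgebra Q) a ∧ c = SqClass.mk (Additive.ofMul a)

/-- The spinor norm `δ : O(Q) → Fˣ/(Fˣ)²`. -/
def spinorNorm (g : orthogonalGroup Q) : SqClass F :=
  Classical.epsilon (IsSpinorNorm Q g)

end SpinorNorm

/-! ## Stiefel-Whitney classes of orthogonal representations -/

section StiefelWhitney

variable {G : Type*} [Group G] [TopologicalSpace G]
  {k : Type*} [Field k] {W : Type*} [AddCommGroup W] [Module k W] (q : QuadraticForm k W)

/-- The group of `x ∈ Cl(q)` with `N(x) = 1`; if `k` is algebraically closed of characteristic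
different from `2` it is the extension of `O(q)` by `μ₂ = {1, -1}` in which a reflection in a vector
`v` with `q(v) = 1` lifts to the element `v` of order `2`. -/
def pin : Subgroup (cliffordGroup q) where
  carrier := {x | cliffordNorm q x = 1}
  one_mem' := by simp [cliffordNorm]
  mul_mem' := by
    intro x y hx hy
    simp only [Set.mem_ofPred_eq, cliffordNorm] at hx hy ⊢
    rw [Subgroup.coe_mul, Units.val_mul, CliffordAlgebra.reverse.map_mul, mul_assoc,
      ← mul_assoc _ (x.1 : CliffordAlgebra q), hx, one_mul, hy]
  inv_mem' := by
    intro x hx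
    simp only [Set.mem_ofPred_eq, cliffordNorm] at hx ⊢
    have h : CliffordAlgebra.reverse (x.1 : CliffordAlgebra q) =
        ((x.1⁻¹ : (CliffordAlgebra q)ˣ) : CliffordAlgebra q) :=
      Units.eq_inv_of_mul_eq_one_right hx
    rw [Subgroup.coe_inv, ← h, CliffordAlgebra.reverse_reverse, h, Units.mul_inv]

/-- `IsSW2 q ψ y`: `y ∈ H²(G, 𝔽₂)` is the second Stiefel-Whitney class of the orthogonal
representation `ψ`. In characteristic different from `2` it is the image of `ψ` under the connecting
map of `1 → μ₂ → pin(q) → O(q) → 1` (trivial `G`-actions): for a continuous lifting `b` of `ψ` to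
`pin(q)` it is the class of the cocycle `b_s b_t b_{st}⁻¹` in `μ₂ = 𝔽₂`. In characteristic `2` it is
zero by definition. -/
def IsSW2 (ψ : G →* orthogonalGroup q)
    (y : H2 (1 : G →* AddMonoid.End (ZMod 2))) : Prop :=
  ((2 : k) ≠ 0 → ∃ b : G → pin q, IsLocallyConstant b ∧ (∀ s, IsLift q (b s).1 (ψ s)) ∧
    ∃ z : Z2 (1 : G →* AddMonoid.End (ZMod 2)), y = H2.mk z ∧
      ∀ s t, ((b s * b t).1.1 : CliffordAlgebra q) =
        algebraMap k _ ((sgn k (z.1 (s, t))).toMul : kˣ) * ((b (s * t)).1.1 : CliffordAlgebra q)) ∧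
  ((2 : k) = 0 → y = 0)

/-- `c = (SW₁(ψ), SW₂(ψ))`, where `SW₁(ψ) = deg ∘ ψ`. -/
def IsStiefelWhitney (ψ : G →* orthogonalGroup q)
    (c : H1 G (ZMod 2) × H2 (1 : G →* AddMonoid.End (ZMod 2))) : Prop :=
  (∀ s, IsDegree q (ψ s) (c.1.1 s)) ∧ IsSW2 q ψ c.2

/-- The (truncated) Stiefel-Whitney class `SW(ψ) ∈ H¹(G, 𝔽₂) × H²(G, 𝔽₂)` of an orthogonal
representation `ψ` of `G` on a quadratic space over an algebraically closed field. -/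
def stiefelWhitney (ψ : G →* orthogonalGroup q) :
    H1 G (ZMod 2) × H2 (1 : G →* AddMonoid.End (ZMod 2)) :=
  Classical.epsilon (IsStiefelWhitney q ψ)

end StiefelWhitney

section SWBar

variable {F : Type*} [Field F] {Fs : Type*} [Field Fs] [Algebra F Fs]
  {V : Type*} [AddCommGroup V] [Module F V] {Q : QuadraticForm F V}

/-- The representation `φ_k` obtained from `φ : Γ → O(Q)(F)` by extension of scalars. -/
def scalarExt (k : Type*) [Field k] [Algebra F k] (φ : Gal(Fs/F) →* orthogonalGroup Q) :
    Gal(Fs/F) →* orthogonalGroup (baseChange k Q) :=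
  (orthogonalBaseChange k Q).comp φ

/-- The image of `SW(φ_k)` in the little graded Brauer group. -/
def swBar (k : Type*) [Field k] [Algebra F k] (φ : Gal(Fs/F) →* orthogonalGroup Q) : BrS F Fs :=
  ⟨(stiefelWhitney _ (scalarExt k φ)).1, toBr F Fs (stiefelWhitney _ (scalarExt k φ)).2⟩

end SWBar

/-! ## Galois actions, twisting, and relative Hasse-Witt invariants -/

section Galois

variable {F : Type*} [Field F] {Fs : Type*} [Field Fs] [Algebra F Fs]

section Action

variable (V : Type*) [AddCommGroup V] [Module F V]

/-- The semilinear action of `Γ` on `Fs ⊗ V`: `σ(a ⊗ v) = σ(a) ⊗ v`. -/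
def galTensor (σ : Gal(Fs/F)) : Fs ⊗[F] V ≃ₗ[F] Fs ⊗[F] V :=
  LinearEquiv.rTensor V σ.toLinearEquiv

variable {V}

theorem galTensor_tmul (σ : Gal(Fs/F)) (a : Fs) (v : V) :
    galTensor V σ (a ⊗ₜ v) = σ a ⊗ₜ v := rfl

theorem galTensor_smul (σ : Gal(Fs/F)) (a : Fs) (x : Fs ⊗[F] V) :
    galTensor V σ (a • x) = σ a • galTensor V σ x := by
  induction x using TensorProduct.induction_on with
  | zero => simp
  | tmul b v => simp [galTensor_tmul, TensorProduct.smul_tmul']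
  | add x y hx hy => simp only [smul_add, map_add, hx, hy]

theorem galTensor_inv_apply (σ : Gal(Fs/F)) (x : Fs ⊗[F] V) :
    galTensor V σ (galTensor V σ⁻¹ x) = x := by
  induction x using TensorProduct.induction_on with
  | zero => simp
  | tmul b v =>
    rw [galTensor_tmul, galTensor_tmul]
    exact congrArg (· ⊗ₜ[F] v) (σ.apply_symm_apply b)
  | add x y hx hy => simp only [map_add, hx, hy]

theorem galTensor_apply_inv (σ : Gal(Fs/F)) (x : Fs ⊗[F] V) :
    galTensor V σ⁻¹ (galTensor V σ x) = x := by
  have := galTensor_inv_apply σ⁻¹ x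
  rwa [inv_inv] at this

theorem baseChange_galTensor (Q : QuadraticForm F V) (σ : Gal(Fs/F)) (x : Fs ⊗[F] V) :
    baseChange Fs Q (galTensor V σ x) = σ (baseChange Fs Q x) := by
  change LinearMap.BilinForm.baseChange Fs _ _ _ = σ (LinearMap.BilinForm.baseChange Fs _ _ _)
  generalize (LinearMap.BilinMap.toQuadraticMap_surjective Q).choose = β
  suffices h : ∀ x y : Fs ⊗[F] V, LinearMap.BilinForm.baseChange Fs β (galTensor V σ x)
      (galTensor V σ y) = σ (LinearMap.BilinForm.baseChange Fs β x y) from h x x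
  intro x y
  induction x using TensorProduct.induction_on with
  | zero => simp
  | add x x' hx hx' => simp only [map_add, LinearMap.add_apply, hx, hx']
  | tmul a v =>
    induction y using TensorProduct.induction_on with
    | zero => simp
    | add y y' hy hy' => simp only [map_add, hy, hy']
    | tmul b w =>
      rw [galTensor_tmul, galTensor_tmul, LinearMap.BilinForm.baseChange_tmul,
        LinearMap.BilinForm.baseChange_tmul, map_smul, map_mul]

end Action

section CliffordAction

/-- The universal property of the Clifford algebra for semilinear data: a ring homomorphism
`j : K → B` with central image and an additive `f : W → B` with `f(a w) = j(a) f(w)` and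
`f(w)² = j(q(w))` induce a ring homomorphism from the Clifford algebra to `B`. -/
def cliffordLift {K W B : Type*} [CommRing K] [AddCommGroup W] [Module K W] [Ring B]
    (q : QuadraticForm K W) (j : K →+* B) (hj : ∀ a b, j a * b = b * j a) (f : W →+ B)
    (hf : ∀ (a : K) w, f (a • w) = j a * f w) (hq : ∀ w, f w * f w = j (q w)) :
    CliffordAlgebra q →+* B :=
  letI : Algebra K B := j.toAlgebra' hj
  (CliffordAlgebra.lift q ⟨{ f with map_smul' := hf }, hq⟩ : CliffordAlgebra q →ₐ[K] B).toRingHom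

variable {V : Type*} [AddCommGroup V] [Module F V] (Q : QuadraticForm F V)

/-- The semilinear action of `Γ` on the Clifford algebra of `Fs ⊗ V`: `σ` acts on scalars and on
`Fs ⊗ V` in the natural way, see `galClifford_algebraMap` and `galClifford_ι`. -/
def galClifford (σ : Gal(Fs/F)) :
    CliffordAlgebra (baseChange Fs Q) →+* CliffordAlgebra (baseChange Fs Q) :=
  cliffordLift (baseChange Fs Q)
    ((algebraMap Fs (CliffordAlgebra (baseChange Fs Q))).comp (σ : Fs →+* Fs))
    (fun a b => Algebra.commutes (σ a) b)
    ((CliffordAlgebra.ι (baseChange Fs Q)).toAddMonoidHom.comp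
      (galTensor V σ).toLinearMap.toAddMonoidHom)
    (fun a w => by
      change CliffordAlgebra.ι _ (galTensor V σ (a • w)) =
        algebraMap Fs _ (σ a) * CliffordAlgebra.ι _ (galTensor V σ w)
      rw [galTensor_smul, map_smul, Algebra.smul_def])
    (fun w => by
      change CliffordAlgebra.ι _ (galTensor V σ w) * CliffordAlgebra.ι _ (galTensor V σ w) =
        algebraMap Fs _ (σ (baseChange Fs Q w))
      rw [CliffordAlgebra.ι_sq_scalar, baseChange_galTensor])

theorem galClifford_algebraMap (σ : Gal(Fs/F)) (a : Fs) :
    galClifford Q σ (algebraMap Fs _ a) = algebraMap Fs _ (σ a) := by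
  let j : Fs →+* CliffordAlgebra (baseChange Fs Q) :=
    (algebraMap Fs (CliffordAlgebra (baseChange Fs Q))).comp (σ : Fs →+* Fs)
  exact @AlgHom.commutes Fs (CliffordAlgebra (baseChange Fs Q))
    (CliffordAlgebra (baseChange Fs Q)) _ _ _ _ (j.toAlgebra' fun a b => Algebra.commutes (σ a) b) _ a

theorem galClifford_ι (σ : Gal(Fs/F)) (w : Fs ⊗[F] V) :
    galClifford Q σ (CliffordAlgebra.ι _ w) = CliffordAlgebra.ι _ (galTensor V σ w) := by
  let j : Fs →+* CliffordAlgebra (baseChange Fs Q) :=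
    (algebraMap Fs (CliffordAlgebra (baseChange Fs Q))).comp (σ : Fs →+* Fs)
  exact @CliffordAlgebra.lift_ι_apply Fs _ (Fs ⊗[F] V) _ _ (baseChange Fs Q)
    (CliffordAlgebra (baseChange Fs Q)) _ (j.toAlgebra' fun a b => Algebra.commutes (σ a) b) _ _ w

end CliffordAction

section Twist

variable {V : Type*} [AddCommGroup V] [Module F V] {Q : QuadraticForm F V}

/-- The twist of `V` by `θ`: the `F`-space of all `v ∈ Fs ⊗ V` with `θ_σ(σ(v)) = v` for all `σ`. -/
def twistedSpace (θ : Gal(Fs/F) → orthogonalGroup (baseChange Fs Q)) :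
    Submodule F (Fs ⊗[F] V) where
  carrier := {v | ∀ σ, (θ σ).1 (galTensor V σ v) = v}
  zero_mem' σ := by rw [map_zero, map_zero]
  add_mem' hv hw σ := by rw [map_add, map_add, hv σ, hw σ]
  smul_mem' a v hv σ := by
    rw [map_smul, ← algebraMap_smul Fs a, map_smul, hv σ,
      algebraMap_smul]

variable (F Fs) in
/-- An `F`-linear retraction of `F → Fs`. -/
def retraction : Fs →ₗ[F] F :=
  ((Algebra.linearMap F Fs).exists_leftInverse_of_injective
    (LinearMap.ker_eq_bot.2 (algebraMap F Fs).injective)).choose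

/-- The twisted form `Q_θ`: the restriction of the extension of `Q` to `twistedSpace θ`, on which it
takes values in `F`, see `algebraMap_twistedForm` (the retraction `Fs → F` only serves to regard
these values as elements of `F`). -/
def twistedForm (θ : Gal(Fs/F) → orthogonalGroup (baseChange Fs Q)) :
    QuadraticForm F (twistedSpace θ) :=
  ((retraction F Fs).compQuadraticMap' (baseChange Fs Q)).comp (twistedSpace θ).subtype

theorem algebraMap_twistedForm [IsSepClosure F Fs]
    (θ : Gal(Fs/F) → orthogonalGroup (baseChange Fs Q)) (v : twistedSpace θ) :
    algebraMap F Fs (twistedForm θ v) = baseChange Fs Q v.1 := by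
  have : IsGalois F Fs := IsSepClosure.isGalois
  obtain ⟨a, ha⟩ := (InfiniteGalois.mem_range_algebraMap_iff_fixed (k := F) _).2
    (fun σ : Gal(Fs/F) => by
      rw [← baseChange_galTensor Q σ v.1, ← (θ σ).2, v.2 σ])
  change algebraMap F Fs (retraction F Fs (baseChange Fs Q v.1)) = _
  rw [← ha]
  exact congrArg _ (LinearMap.congr_fun ((Algebra.linearMap F Fs).exists_leftInverse_of_injective
    (LinearMap.ker_eq_bot.2 (algebraMap F Fs).injective)).choose_spec a)

end Twist

section HasseWitt

variable {V : Type*} [AddCommGroup V] [Module F V] {Q : QuadraticForm F V}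
  {V' : Type*} [AddCommGroup V'] [Module F V'] {Q' : QuadraticForm F V'}

/-- The `1`-cocycle `a_σ = u⁻¹ σ(u)` of `Γ` in `O(Q)(Fs)` given by an isometry
`u : Fs ⊗ V → Fs ⊗ V'`, where `σ(u) = σ ∘ u ∘ σ⁻¹`; it represents `inv(Q', Q)`. -/
def invCocycle (u : (baseChange Fs Q).IsometryEquiv (baseChange Fs Q')) (σ : Gal(Fs/F)) :
    orthogonalGroup (baseChange Fs Q) :=
  ⟨{ toFun := fun x => u.toLinearEquiv.symm
        (galTensor V' σ (u.toLinearEquiv (galTensor V σ⁻¹ x)))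
     map_add' := fun x y => by simp only [map_add]
     map_smul' := fun a x => by
      rw [galTensor_smul, map_smul, galTensor_smul, map_smul, RingHom.id_apply]
      exact congrArg (· • _) (σ.apply_symm_apply a)
     invFun := fun x => galTensor V σ
        (u.toLinearEquiv.symm (galTensor V' σ⁻¹ (u.toLinearEquiv x)))
     left_inv := fun x => by
      simp only [LinearEquiv.apply_symm_apply, galTensor_apply_inv, LinearEquiv.symm_apply_apply,
        galTensor_inv_apply]
     right_inv := fun x => by
      simp only [LinearEquiv.apply_symm_apply, galTensor_apply_inv, LinearEquiv.symm_apply_apply,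
        galTensor_inv_apply] },
   fun x => by
    have h : ∀ y, baseChange Fs Q (u.toLinearEquiv.symm y) = baseChange Fs Q' y := fun y =>
      u.symm.map_app y
    change baseChange Fs Q (u.toLinearEquiv.symm
        (galTensor V' σ (u.toLinearEquiv (galTensor V σ⁻¹ x)))) = _
    rw [h, baseChange_galTensor]
    have h2 : baseChange Fs Q' (u.toLinearEquiv (galTensor V σ⁻¹ x)) =
      baseChange Fs Q (galTensor V σ⁻¹ x) := u.map_app _
    rw [h2, ← baseChange_galTensor, galTensor_inv_apply]⟩

/-- `IsConnecting a x`: the class `x ∈ Br(F) = H²(Γ, Fsˣ)` is the image `∂(a)` of the `1`-cocycle `a`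
of `Γ` in `O(Q)(Fs)` under the connecting map of `1 → Fsˣ → Cl(Q)(Fs) → O(Q)(Fs) → 1`: for a
continuous lifting `b` of `a` to `Cl(Q)(Fs)`, it is the class of `b_σ σ(b_τ) b_{στ}⁻¹`. -/
def IsConnecting (a : Gal(Fs/F) → orthogonalGroup (baseChange Fs Q)) (x : Br F Fs) : Prop :=
  ∃ b : Gal(Fs/F) → cliffordGroup (baseChange Fs Q), IsLocallyConstant b ∧
    (∀ σ, IsLift _ (b σ) (a σ)) ∧
    ∃ z : Z2 (galUnits F Fs), x = H2.mk z ∧ ∀ σ τ,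
      ((b σ).1 : CliffordAlgebra (baseChange Fs Q)) * galClifford Q σ (b τ).1 =
        algebraMap Fs _ ((z.1 (σ, τ)).toMul : Fsˣ) * ((b (σ * τ)).1 : CliffordAlgebra _)

variable (Q' Q) in
/-- `h = (HW₁(Q', Q), HW₂(Q', Q))`: for a cocycle `a` representing `inv(Q', Q)`, the component
`HW₁` is `deg ∘ a` and the component `HW₂` is `∂(a)`. -/
def IsHasseWitt (h : BrS F Fs) : Prop :=
  ∃ u : (baseChange Fs Q).IsometryEquiv (baseChange Fs Q'),
    (∀ σ, IsDegree _ (invCocycle u σ) (h.fst.1 σ)) ∧ IsConnecting (invCocycle u) h.snd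

variable (Fs Q' Q) in
/-- The relative Hasse-Witt invariant `HW(Q', Q)`. -/
def hasseWitt : BrS F Fs :=
  haveI : Nonempty (BrS F Fs) := ⟨0⟩
  Classical.epsilon (IsHasseWitt Q' Q)

end HasseWitt

section TwistRep

variable {V : Type*} [AddCommGroup V] [Module F V] {Q : QuadraticForm F V}

/-- The twist `V_φ` of `V` by `φ : Γ → O(Q)(F)`, viewed as a `1`-cocycle in `O(Q)(Fs)`: the
`F`-space of all `v ∈ Fs ⊗ V` with `φ(σ)(σ(v)) = v` for all `σ`. -/
def TwistByRep (φ : Gal(Fs/F) →* orthogonalGroup Q) : Type _ :=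
  twistedSpace fun σ => orthogonalBaseChange Fs Q (φ σ)

instance (φ : Gal(Fs/F) →* orthogonalGroup Q) : AddCommGroup (TwistByRep φ) :=
  inferInstanceAs (AddCommGroup (twistedSpace fun σ => orthogonalBaseChange Fs Q (φ σ)))

instance (φ : Gal(Fs/F) →* orthogonalGroup Q) : Module F (TwistByRep φ) :=
  inferInstanceAs (Module F (twistedSpace fun σ => orthogonalBaseChange Fs Q (φ σ)))

/-- The twisted form `Q_φ` on `V_φ`. -/
def twistByRep (φ : Gal(Fs/F) →* orthogonalGroup Q) : QuadraticForm F (TwistByRep φ) :=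
  twistedForm fun σ => orthogonalBaseChange Fs Q (φ σ)

end TwistRep

end Galois

end

end FrohlichTheory

/-! One lifting computes all three invariants. Choose lifts b_σ of φ(σ) in the Clifford group over F
itself, locally constant in σ, with norms n_σ ∈ Fˣ in the square class δ(φ(σ)). Then b_σ b_τ =
y(σ,τ) b_{στ} with y(σ,τ) ∈ Fˣ. The cocycle attached to Q_φ is φ itself, and Γ fixes the b_σ, so y
represents the second component of HW(Q_φ, Q). Over k take square roots r_σ of n_σ. The elements
r_σ⁻¹ b_σ have norm 1, so their factor set is a sign (-1)^z, and z represents SW₂(φ). The roots can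
be chosen with r_σ r_τ = p(σ,τ) r_{στ}, where p takes values in Fˣ and represents ξ(δ∘φ). Comparing
factor sets gives y = (-1)^z p. The degree components agree, and 2ξ = 0 makes the sign of the
difference irrelevant. In characteristic 2, taking norms gives y² = p², hence y = p, in accordance
with SW₂ = 0.

Two facts about Cl(q) → O(q) are needed over an arbitrary field. Its kernel consists of scalars
(`exists_algebraMap_of_ι_mul_eq`): twisted commutators with vectors are contractions, and only
scalars are killed by all contractions. It is surjective, with lifts of scalar norm
(`hasNormedLift`): every isometry is a product of reflections and Siegel transformations.

The other ingredients are Galois descent for the twist (`exists_basis_twistedSpace`,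
`invCocycle_twistByRep`), the calculus of factor sets (`exists_cocycle_of_factorSet`,
`mk_eq_mk_of_factorSet`), and the explicit cocycle for ξ (`exists_cocycle_xi`). They are assembled
in `exists_isSW2` and `exists_invariants`. -/

namespace FrohlichTheory

/-! ## Clifford algebras of nondegenerate quadratic forms -/

section CliffordCenter

open CliffordAlgebra

variable {K : Type*} [Field K] {W : Type*} [AddCommGroup W] [Module K W]

/-- Both sides obey the same recursion under left multiplication by a vector, because e ∧ e = 0.
When d e = 1 the map on the left is induced by the projection onto ker d along e, so this projection
fixes every x with zero contraction by d. -/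
theorem exteriorMap_sub_smulRight (d : Module.Dual K W) (e : W) (x : CliffordAlgebra (0 : QuadraticForm K W)) :
    (ExteriorAlgebra.map (LinearMap.id - d.smulRight e) : ExteriorAlgebra K W →ₐ[K] _) x =
      x - ι 0 e * contractLeft d x := by
  induction x using CliffordAlgebra.left_induction with
  | algebraMap r => rw [contractLeft_algebraMap, mul_zero, sub_zero]; exact AlgHom.commutes _ r
  | add x y hx hy => 
    rw [map_add, map_add, mul_add]
    change (ExteriorAlgebra.map (LinearMap.id - d.smulRight e) : ExteriorAlgebra K W →ₐ[K] _) x +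
      (ExteriorAlgebra.map (LinearMap.id - d.smulRight e) : ExteriorAlgebra K W →ₐ[K] _) y = _
    rw [hx, hy]; abel
  | ι_mul x m hx =>
    refine (map_mul (ExteriorAlgebra.map (LinearMap.id - d.smulRight e)) _ _).trans ?_
    have h1 : ExteriorAlgebra.map (LinearMap.id - d.smulRight e) (ι (0 : QuadraticForm K W) m) =
        ι (0 : QuadraticForm K W) m - d m • ι (0 : QuadraticForm K W) e := by
      refine (ExteriorAlgebra.map_apply_ι _ _).trans ?_
      rw [← map_smul, ← map_sub]; rfl
    rw [h1, hx, contractLeft_ι_mul]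
    have h2 : ι (0 : QuadraticForm K W) m * ι 0 e = - (ι 0 e * ι 0 m) := by
      rw [eq_neg_iff_add_eq_zero, ι_mul_ι_add_swap]; simp [QuadraticMap.polar]
    have h3 : ∀ y, ι (0 : QuadraticForm K W) e * (ι 0 e * y) = 0 := fun y => by
      rw [← mul_assoc, ι_sq_scalar]; simp
    rw [sub_mul, mul_sub, mul_sub, mul_sub, ← mul_assoc, h2, smul_mul_assoc, smul_mul_assoc,
      h3, mul_smul_comm]
    simp only [neg_mul, smul_zero, mul_assoc]
    abel

/-- Such an x is fixed by the endomorphisms induced by id - bᵢ* ⊗ bᵢ, for every basis vector bᵢ.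
These projections compose to the zero map of W, which induces the projection of the exterior algebra
onto the scalars. -/
theorem exists_algebraMap_of_contractLeft_exterior [FiniteDimensional K W]
    (x : CliffordAlgebra (0 : QuadraticForm K W)) (hx : ∀ d, contractLeft d x = 0) :
    ∃ c : K, x = algebraMap K _ c := by
  let b := Module.finBasis K W
  have key : ∀ s : Finset (Fin (Module.finrank K W)),
      (ExteriorAlgebra.map (LinearMap.id - ∑ i ∈ s, (b.coord i).smulRight (b i)) :
        ExteriorAlgebra K W →ₐ[K] _) x = x := by
    intro s
    induction s using Finset.induction_on with
    | empty =>
      rw [Finset.sum_empty, sub_zero, ExteriorAlgebra.map_id]; rfl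
    | insert j s hj ih =>
      have hf : LinearMap.id - ∑ i ∈ insert j s, (b.coord i).smulRight (b i) =
          (LinearMap.id - (b.coord j).smulRight (b j)).comp
            (LinearMap.id - ∑ i ∈ s, (b.coord i).smulRight (b i)) := by
        ext v
        have h0 : ∑ i ∈ s, (Finsupp.single i (b.repr v i)) j = 0 :=
          Finset.sum_eq_zero fun i hi => by
            rw [Finsupp.single_eq_of_ne (by rintro rfl; exact hj hi)]
        simp [Finset.sum_insert hj, LinearMap.sum_apply, h0, map_sum, sub_sub, add_comm]
      rw [hf, ← ExteriorAlgebra.map_comp_map, AlgHom.comp_apply, ih, exteriorMap_sub_smulRight, hx, mul_zero, sub_zero]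
  have h0 : (LinearMap.id - ∑ i, (b.coord i).smulRight (b i)) = (0 : W →ₗ[K] W) := by
    ext v
    simp [LinearMap.sum_apply, b.sum_repr]
  have h1 := key Finset.univ
  rw [h0] at h1
  refine ⟨ExteriorAlgebra.algebraMapInv x, h1.symm.trans ?_⟩
  have h2 : (ExteriorAlgebra.map (0 : W →ₗ[K] W)) =
      (Algebra.ofId K (ExteriorAlgebra K W)).comp ExteriorAlgebra.algebraMapInv := by
    ext v
    simp [ExteriorAlgebra.algebraMapInv]
  exact DFunLike.congr_fun h2 x

variable {q : QuadraticForm K W}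

/-- `changeForm` is a linear isomorphism onto the exterior algebra that commutes with contractions.
The bilinear form B need not be symmetric, which is why this works in characteristic 2. -/
theorem exists_algebraMap_of_contractLeft [FiniteDimensional K W]
    (x : CliffordAlgebra q) (hx : ∀ d, contractLeft d x = 0) : ∃ c : K, x = algebraMap K _ c := by
  obtain ⟨B, hB⟩ := LinearMap.BilinMap.toQuadraticMap_surjective (0 - q)
  obtain ⟨c, hc⟩ := exists_algebraMap_of_contractLeft_exterior (changeForm hB x) (fun d => by
    rw [← changeForm_contractLeft, hx, map_zero])
  refine ⟨c, (changeFormEquiv hB).injective ?_⟩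
  change changeForm hB x = changeForm hB _
  rw [hc, changeForm_algebraMap]

theorem algebraMap_clifford_injective (q : QuadraticForm K W) :
    Function.Injective (algebraMap K (CliffordAlgebra q)) := by
  obtain ⟨B, hB⟩ := LinearMap.BilinMap.toQuadraticMap_surjective (0 - q)
  intro a b hab
  have h := congrArg (changeForm hB) hab
  rw [changeForm_algebraMap, changeForm_algebraMap] at h
  exact (ExteriorAlgebra.algebraMap_inj (R := K) W a b).1 h

/-- Both sides are odd derivations in x, and on a vector m both equal the polar form of w and m. -/
theorem ι_mul_sub_involute_mul_ι (w : W) (x : CliffordAlgebra q) :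
    ι q w * x - involute x * ι q w = contractLeft (q.polarBilin w) x := by
  induction x using CliffordAlgebra.left_induction with
  | algebraMap r => rw [contractLeft_algebraMap, AlgHom.commutes, Algebra.commutes, sub_self]
  | add x y hx hy => rw [map_add, map_add, ← hx, ← hy]; noncomm_ring
  | ι_mul x m hx =>
    rw [contractLeft_ι_mul, ← hx, map_mul, involute_ι, QuadraticMap.polarBilin_apply_apply,
      Algebra.smul_def, ← ι_mul_ι_add_swap]
    noncomm_ring

/-- By nondegeneracy every functional has the form polar(w, ·), so x is killed by all contractions.
This computes the kernel of ρ. -/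
theorem exists_algebraMap_of_ι_mul_eq [FiniteDimensional K W] (hq : q.polarBilin.Nondegenerate)
    (x : CliffordAlgebra q) (hx : ∀ w, ι q w * x = involute x * ι q w) :
    ∃ c : K, x = algebraMap K _ c := by
  refine exists_algebraMap_of_contractLeft x fun d => ?_
  obtain ⟨w, rfl⟩ := (LinearMap.BilinForm.toDual q.polarBilin hq).surjective d
  refine (ι_mul_sub_involute_mul_ι w x).symm.trans ?_
  rw [hx, sub_self]

end CliffordCenter

/-! ## Lifting orthogonal transformations to the Clifford group -/

section CliffordLifts

open CliffordAlgebra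

variable {K : Type*} [Field K] {W : Type*} [AddCommGroup W] [Module K W] {q : QuadraticForm K W}

theorem gradedConj_ι_eq_iff (x : (CliffordAlgebra q)ˣ) (v w : W) :
    gradedConj x (ι q v) = ι q w ↔ involute (x : CliffordAlgebra q) * ι q v = ι q w * x := by
  rw [gradedConj, Units.mul_inv_eq_iff_eq_mul]

theorem isLift_iff (x : cliffordGroup q) (g : orthogonalGroup q) :
    IsLift q x g ↔ ∀ w, involute (x.1 : CliffordAlgebra q) * ι q w = ι q (g.1 w) * x.1 :=
  forall_congr' fun w => gradedConj_ι_eq_iff x.1 w (g.1 w)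

theorem exists_isLift_of_involute_mul (x : (CliffordAlgebra q)ˣ) {i : ZMod 2}
    (hi : (x : CliffordAlgebra q) ∈ evenOdd q i) (g : orthogonalGroup q)
    (h : ∀ w, involute (x : CliffordAlgebra q) * ι q w = ι q (g.1 w) * x) :
    ∃ y : cliffordGroup q, y.1 = x ∧ IsLift q y g := by
  have h' : ∀ w, gradedConj x (ι q w) = ι q (g.1 w) := fun w =>
    (gradedConj_ι_eq_iff x w (g.1 w)).2 (h w)
  refine ⟨⟨x, ⟨i, hi⟩, ?_⟩, rfl, h'⟩
  ext y
  constructor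
  · rintro ⟨_, ⟨v, rfl⟩, rfl⟩
    exact ⟨g.1 v, (h' v).symm⟩
  · rintro ⟨v, rfl⟩
    exact ⟨ι q (g.1.symm v), ⟨_, rfl⟩, by rw [h', LinearEquiv.apply_symm_apply]⟩

theorem IsLift.one : IsLift q 1 1 := fun _ => gradedConj_one _

theorem IsLift.mul {x y : cliffordGroup q} {g h : orthogonalGroup q} (hx : IsLift q x g)
    (hy : IsLift q y h) : IsLift q (x * y) (g * h) := fun w =>
  (gradedConj_mul x.1 y.1 _).trans (by rw [hy, hx]; rfl)

theorem IsLift.inv {x : cliffordGroup q} {g : orthogonalGroup q} (hx : IsLift q x g) :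
    IsLift q x⁻¹ g⁻¹ := fun w => by
  have h := hx (g⁻¹.1 w)
  have hg : g.1 (g⁻¹.1 w) = w := g.1.apply_symm_apply w
  rw [hg] at h
  rw [← h, Subgroup.coe_inv, ← gradedConj_mul, inv_mul_cancel, gradedConj_one]

theorem algebraMap_mul_comm_clifford (c : K) (x : CliffordAlgebra q) :
    algebraMap K _ c * x = x * algebraMap K _ c := Algebra.commutes c x

theorem nontrivial_clifford (q : QuadraticForm K W) : Nontrivial (CliffordAlgebra q) :=
  (algebraMap_clifford_injective q).nontrivial

/-- The element x⁻¹y lifts the identity, hence is a scalar. -/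
theorem IsLift.exists_eq_mul [FiniteDimensional K W] (hq : q.polarBilin.Nondegenerate)
    {x y : cliffordGroup q} {g : orthogonalGroup q} (hx : IsLift q x g) (hy : IsLift q y g) :
    ∃ c : Kˣ, (y.1 : CliffordAlgebra q) = algebraMap K _ (c : K) * x.1 := by
  have h := hx.inv.mul hy
  rw [inv_mul_cancel, isLift_iff] at h
  obtain ⟨c, hc⟩ := exists_algebraMap_of_ι_mul_eq hq _ fun w => (h w).symm
  have hy' : (y.1 : CliffordAlgebra q) = algebraMap K _ c * x.1 := by
    rw [algebraMap_mul_comm_clifford, ← hc]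
    simp
  have := nontrivial_clifford q
  refine ⟨Units.mk0 c ?_, hy'⟩
  rintro rfl
  rw [map_zero, zero_mul] at hy'
  exact y.1.ne_zero hy'

theorem evenOdd_unique {x : cliffordGroup q} {i j : ZMod 2}
    (hi : (x.1 : CliffordAlgebra q) ∈ evenOdd q i) (hj : (x.1 : CliffordAlgebra q) ∈ evenOdd q j) :
    i = j := by
  have := nontrivial_clifford q
  have key : ¬((x.1 : CliffordAlgebra q) ∈ evenOdd q 0 ∧ (x.1 : CliffordAlgebra q) ∈ evenOdd q 1) :=
    fun h => x.1.ne_zero ((Submodule.disjoint_def.1 (evenOdd_isCompl q).disjoint) _ h.1 h.2)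
  have h2 : ∀ i : ZMod 2, i = 0 ∨ i = 1 := by decide
  rcases h2 i with rfl | rfl <;> rcases h2 j with rfl | rfl
  · rfl
  · exact (key ⟨hi, hj⟩).elim
  · exact (key ⟨hj, hi⟩).elim
  · rfl

theorem IsDegree.mul {g h : orthogonalGroup q} {i j : ZMod 2} (hg : IsDegree q g i)
    (hh : IsDegree q h j) : IsDegree q (g * h) (i + j) := by
  obtain ⟨x, hx, hi⟩ := hg
  obtain ⟨y, hy, hj⟩ := hh
  exact ⟨x * y, hx.mul hy, evenOdd_mul_le q _ _ (Submodule.mul_mem_mul hi hj)⟩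

theorem IsDegree.inv {g : orthogonalGroup q} {i : ZMod 2} (hg : IsDegree q g i) :
    IsDegree q g⁻¹ i := by
  obtain ⟨x, hx, hi⟩ := hg
  exact ⟨x⁻¹, hx.inv, inv_mem_evenOdd hi⟩

theorem IsDegree.unique [FiniteDimensional K W] (hq : q.polarBilin.Nondegenerate)
    {g : orthogonalGroup q} {i j : ZMod 2} (hi : IsDegree q g i) (hj : IsDegree q g j) : i = j := by
  obtain ⟨x, hx, hi⟩ := hi
  obtain ⟨y, hy, hj⟩ := hj
  obtain ⟨c, hc⟩ := hx.exists_eq_mul hq hy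
  refine evenOdd_unique (x := y) ?_ hj
  rw [hc, ← Algebra.smul_def]
  exact Submodule.smul_mem _ _ hi

theorem cliffordNorm_mul {x y : cliffordGroup q} {a b : K}
    (hx : cliffordNorm q x = algebraMap K _ a) (hy : cliffordNorm q y = algebraMap K _ b) :
    cliffordNorm q (x * y) = algebraMap K _ (a * b) := by
  simp only [cliffordNorm] at hx hy ⊢
  rw [Subgroup.coe_mul, Units.val_mul, reverse.map_mul, mul_assoc, ← mul_assoc _ (x.1 : CliffordAlgebra q),
    hx, ← mul_assoc, ← algebraMap_mul_comm_clifford, mul_assoc, hy, map_mul]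

/-- `g` has a lift to the Clifford group with scalar norm. -/
def HasNormedLift (q : QuadraticForm K W) (g : orthogonalGroup q) : Prop :=
  ∃ (x : cliffordGroup q) (a : Kˣ), IsLift q x g ∧
    cliffordNorm q x = algebraMap K (CliffordAlgebra q) a

theorem HasNormedLift.one : HasNormedLift q 1 := ⟨1, 1, IsLift.one, by simp [cliffordNorm]⟩

theorem HasNormedLift.mul {g h : orthogonalGroup q} (hg : HasNormedLift q g)
    (hh : HasNormedLift q h) : HasNormedLift q (g * h) := by
  obtain ⟨x, a, hx, ha⟩ := hg
  obtain ⟨y, b, hy, hb⟩ := hh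
  exact ⟨x * y, a * b, hx.mul hy, by rw [Units.val_mul]; exact cliffordNorm_mul ha hb⟩

/-! ### Generation of the orthogonal group by reflections and Siegel transformations -/

/-- The lift is the vector u itself, of norm q(u). The formula uses the polar form and involves no
division by 2, so it covers orthogonal transvections in characteristic 2. -/
theorem exists_reflection (u : W) (hu : q u ≠ 0) : ∃ s : orthogonalGroup q, HasNormedLift q s ∧
    ∀ v, s.1 v = v - ((q u)⁻¹ * QuadraticMap.polar q u v) • u := by
  have hf : ((q u)⁻¹ • q.polarBilin u) u = 2 := by
    simp only [LinearMap.smul_apply, QuadraticMap.polarBilin_apply_apply, QuadraticMap.polar_self,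
      smul_eq_mul, nsmul_eq_mul]
    field_simp
    norm_num
  have hs : ∀ v, Module.reflection hf v = v - ((q u)⁻¹ * QuadraticMap.polar q u v) • u := fun v => by
    rw [Module.reflection_apply]; rfl
  let s : orthogonalGroup q := ⟨Module.reflection hf, fun v => by
    rw [hs, sub_eq_add_neg, ← neg_smul, QuadraticMap.map_add ⇑q, QuadraticMap.map_smul,
      QuadraticMap.polar_smul_right, QuadraticMap.polar_comm q v u]
    simp only [smul_eq_mul]
    field_simp
    ring⟩
  let x : (CliffordAlgebra q)ˣ :=
    { val := ι q u
      inv := algebraMap K _ (q u)⁻¹ * ι q u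
      val_inv := by
        rw [← mul_assoc, ← Algebra.commutes, mul_assoc, ι_sq_scalar, ← map_mul, inv_mul_cancel₀ hu,
          map_one]
      inv_val := by
        rw [mul_assoc, ι_sq_scalar, ← map_mul, inv_mul_cancel₀ hu, map_one] }
  obtain ⟨y, hy, hys⟩ := exists_isLift_of_involute_mul x (ι_mem_evenOdd_one q u) s (fun w => by
    change involute (ι q u) * ι q w = ι q (Module.reflection hf w) * ι q u
    rw [hs, map_sub, map_smul, sub_mul, smul_mul_assoc, ι_sq_scalar, involute_ι, Algebra.smul_def,
      ← RingHom.map_mul, mul_right_comm, inv_mul_cancel₀ hu, one_mul, ← ι_mul_ι_add_swap]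
    noncomm_ring)
  refine ⟨s, ⟨y, Units.mk0 _ hu, hys, ?_⟩, hs⟩
  rw [cliffordNorm, hy]
  change reverse (ι q u) * ι q u = _
  rw [reverse_ι, ι_sq_scalar]; rfl

/-- The product ef has square zero, so 1 + ef is a unit with inverse 1 - ef, and its norm is 1.
These isometries are needed because reflections alone do not always generate: the hyperbolic space
of dimension 4 over 𝔽₂ is an exception. -/
theorem exists_siegelTransformation (e f : W) (he : q e = 0) (hf : q f = 0)
    (hef : QuadraticMap.polar q e f = 0) : ∃ s : orthogonalGroup q, HasNormedLift q s ∧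
    ∀ v, s.1 v = v + QuadraticMap.polar q f v • e - QuadraticMap.polar q e v • f := by
  -- The vector f is kept as a parameter so that the inverse of T f is T (-f).
  let T : W → W →ₗ[K] W := fun f =>
    LinearMap.id + (q.polarBilin f).smulRight e - (q.polarBilin e).smulRight f
  have hT : ∀ f v, T f v = v + QuadraticMap.polar q f v • e - QuadraticMap.polar q e v • f :=
    fun f v => rfl
  have hfe : QuadraticMap.polar q f e = 0 := by rw [QuadraticMap.polar_comm, hef]
  have hinv : ∀ f, q f = 0 → QuadraticMap.polar q e f = 0 → ∀ v, T f (T (-f) v) = v := by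
    intro f hf hef v
    have hfe : QuadraticMap.polar q f e = 0 := by rw [QuadraticMap.polar_comm, hef]
    simp only [hT, QuadraticMap.polar_add_right, QuadraticMap.polar_sub_right,
      QuadraticMap.polar_smul_right, QuadraticMap.polar_neg_left, QuadraticMap.polar_neg_right,
      QuadraticMap.polar_self, hf, he, hef, hfe]
    module
  let E : W ≃ₗ[K] W := LinearEquiv.ofLinearMap (T f) (T (-f)) (LinearMap.ext (hinv f hf hef))
    (LinearMap.ext fun v => by
      have := hinv (-f) (by rw [QuadraticMap.map_neg, hf])
        (by rw [QuadraticMap.polar_neg_right, hef, neg_zero]) v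
      rwa [neg_neg] at this)
  let s : orthogonalGroup q := ⟨E, fun v => by
    change q (T f v) = q v
    rw [hT, sub_eq_add_neg, ← neg_smul, QuadraticMap.map_add ⇑q, QuadraticMap.map_add ⇑q,
      QuadraticMap.map_smul, QuadraticMap.map_smul]
    simp only [QuadraticMap.polar_add_left, QuadraticMap.polar_smul_left,
      QuadraticMap.polar_smul_right, he, hf, hef, smul_eq_mul,
      QuadraticMap.polar_comm q v f, QuadraticMap.polar_comm q v e]
    ring⟩
  have h1 : ι q e * ι q e = 0 := by rw [ι_sq_scalar, he, map_zero]
  have h2 : ι q f * ι q f = 0 := by rw [ι_sq_scalar, hf, map_zero]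
  have h3 : ι q f * ι q e = - (ι q e * ι q f) := by
    rw [eq_neg_iff_add_eq_zero, ι_mul_ι_add_swap, hfe, map_zero]
  have h4 : ι q e * ι q f * (ι q e * ι q f) = 0 := by
    rw [mul_assoc, ← mul_assoc (ι q f), h3, neg_mul, mul_neg, mul_assoc (ι q e), h2]; simp
  let x : (CliffordAlgebra q)ˣ :=
    { val := 1 + ι q e * ι q f
      inv := 1 - ι q e * ι q f
      val_inv := by rw [mul_sub, add_mul, add_mul, h4]; simp
      inv_val := by rw [mul_add, sub_mul, sub_mul, h4]; simp }
  obtain ⟨y, hy, hys⟩ := exists_isLift_of_involute_mul (i := 0) x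
    (Submodule.add_mem _ (one_le_evenOdd_zero q (Submodule.one_le.1 le_rfl))
      (ι_mul_ι_mem_evenOdd_zero q e f)) s (fun w => by
    change involute (1 + ι q e * ι q f) * ι q w = ι q (T f w) * (1 + ι q e * ι q f)
    rw [hT, LinearMap.map_sub, LinearMap.map_add, LinearMap.map_smul, LinearMap.map_smul,
      Algebra.smul_def, Algebra.smul_def, ← ι_mul_ι_add_swap, ← ι_mul_ι_add_swap]
    rw [map_add, map_mul, map_one, involute_ι, involute_ι, neg_mul_neg]
    have h5 : ι q f * (ι q e * ι q f) = 0 := by rw [← mul_assoc, h3, neg_mul, mul_assoc, h2]; simp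
    have h6 : ι q e * (ι q e * ι q f) = 0 := by rw [← mul_assoc, h1, zero_mul]
    have h7 : (ι q f * ι q w + ι q w * ι q f) * ι q e =
        ι q e * (ι q f * ι q w + ι q w * ι q f) := by
      rw [ι_mul_ι_add_swap]; exact Algebra.commutes _ _
    rw [mul_add, mul_one, sub_mul, add_mul (ι q w) _ (ι q e * ι q f), mul_assoc _ (ι q e) (ι q e * ι q f),
      mul_assoc _ (ι q f) (ι q e * ι q f), h5, h6, h7]
    noncomm_ring)
  refine ⟨s, ⟨y, 1, hys, ?_⟩, fun v => rfl⟩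
  rw [cliffordNorm, hy]
  change reverse (1 + ι q e * ι q f) * (1 + ι q e * ι q f) = _
  rw [map_add, reverse.map_mul, reverse.map_one, reverse_ι, reverse_ι, h3, mul_add, add_mul, add_mul,
    neg_mul, neg_mul, h4]
  simp

/-- It implies that the reflection in gv - v, when that vector is anisotropic, sends v to gv. -/
theorem map_sub_eq_neg_polar (g : orthogonalGroup q) (v : W) :
    q (g.1 v - v) = - QuadraticMap.polar q (g.1 v - v) v := by
  have h : q (g.1 v) = q v := g.2 v
  rw [QuadraticMap.polar_sub_left, QuadraticMap.polar_self, sub_eq_add_neg, QuadraticMap.map_add ⇑q,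
    QuadraticMap.map_neg, QuadraticMap.polar_neg_right, h]
  ring

theorem polar_map_sub_of_fixed (g : orthogonalGroup q) (v : W) {w : W} (hw : g.1 w = w) :
    QuadraticMap.polar q (g.1 v - v) w = 0 := by
  have h : ∀ v w, QuadraticMap.polar q (g.1 v) (g.1 w) = QuadraticMap.polar q v w := fun v w => by
    have h := g.2 (v + w)
    rw [map_add] at h
    rw [QuadraticMap.polar, QuadraticMap.polar, h, g.2, g.2]
  rw [QuadraticMap.polar_sub_left]
  nth_rw 1 [← hw]
  rw [h, sub_self]

/-- If some gv - v is anisotropic, reflect in it. Otherwise the image of g - 1 is totally isotropic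
and a Siegel transformation built from two of its vectors does the job. Either way s fixes the fixed
vectors of g, because they are orthogonal to the image of g - 1. -/
theorem exists_normedLift_agree (hq : q.polarBilin.Nondegenerate) (g : orthogonalGroup q)
    (hg : g ≠ 1) : ∃ s : orthogonalGroup q, HasNormedLift q s ∧ (∀ w, g.1 w = w → s.1 w = w) ∧
      ∃ v, g.1 v ≠ v ∧ s.1 v = g.1 v := by
  by_cases h : ∃ v, q (g.1 v - v) ≠ 0
  · obtain ⟨v, hv⟩ := h
    obtain ⟨s, hs, hsv⟩ := exists_reflection _ hv
    refine ⟨s, hs, fun w hw => ?_, v, fun h => hv (by rw [h, sub_self, QuadraticMap.map_zero]), ?_⟩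
    · rw [hsv, polar_map_sub_of_fixed g v hw, mul_zero, zero_smul, sub_zero]
    · rw [hsv, ← neg_eq_iff_eq_neg.2 (map_sub_eq_neg_polar g v), mul_neg, inv_mul_cancel₀ hv]
      module
  · push Not at h
    have h' : ∀ v, QuadraticMap.polar q (g.1 v - v) v = 0 := fun v => by
      rw [← neg_eq_zero, ← map_sub_eq_neg_polar, h]
    obtain ⟨v, hv⟩ : ∃ v, g.1 v ≠ v := by
      by_contra! hc
      exact hg (Subtype.ext (LinearEquiv.ext hc))
    obtain ⟨w, hw⟩ : ∃ w, QuadraticMap.polar q (g.1 v - v) w ≠ 0 := by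
      by_contra! hc
      exact hv (sub_eq_zero.1 (hq.1 _ hc))
    set e := g.1 v - v with he
    set f := g.1 w - w with hf
    set c := QuadraticMap.polar q e w with hc
    have hadd : g.1 (v + w) - (v + w) = e + f := by rw [map_add, he, hf]; abel
    have hef : QuadraticMap.polar q e f = 0 := by
      rw [QuadraticMap.polar, ← hadd, h, h, h]; simp
    -- The form polar(gx - x, y) is alternating in (x, y), since it vanishes for x = y. This is that
    -- fact at v + w.
    have hfv : QuadraticMap.polar q f v = -c := by
      have := h' (v + w)
      rw [hadd, QuadraticMap.polar_add_left, QuadraticMap.polar_add_right,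
        QuadraticMap.polar_add_right, h', h', zero_add, add_zero] at this
      rw [eq_neg_iff_add_eq_zero, add_comm, this]
    -- The factor -c⁻¹ makes the pairing with v equal to 1, so that s v = v + e = g v.
    obtain ⟨s, hs, hsv⟩ := exists_siegelTransformation e (-(c⁻¹ • f)) (h v)
      (by rw [QuadraticMap.map_neg, QuadraticMap.map_smul, h]; simp)
      (by rw [QuadraticMap.polar_neg_right, QuadraticMap.polar_smul_right, hef]; simp)
    refine ⟨s, hs, fun x hx => ?_, v, hv, ?_⟩
    · rw [hsv, polar_map_sub_of_fixed g v hx, QuadraticMap.polar_neg_left,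
        QuadraticMap.polar_smul_left, polar_map_sub_of_fixed g w hx]
      simp
    · rw [hsv, h' v, QuadraticMap.polar_neg_left, QuadraticMap.polar_smul_left, hfv, smul_eq_mul,
        mul_neg, neg_neg, inv_mul_cancel₀ hw, one_smul, zero_smul, sub_zero, he]
      abel

/-- Cartan–Dieudonné induction on the codimension of the fixed space: passing from g to s⁻¹g
strictly enlarges that space. -/
theorem hasNormedLift [FiniteDimensional K W] (hq : q.polarBilin.Nondegenerate)
    (g : orthogonalGroup q) : HasNormedLift q g := by
  suffices H : ∀ (n : ℕ) (g : orthogonalGroup q),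
      Module.finrank K W ≤ Module.finrank K (LinearMap.eqLocus g.1.toLinearMap LinearMap.id) + n →
        HasNormedLift q g from H _ g (Nat.le_add_left _ _)
  intro n
  induction n with
  | zero =>
    intro g hg
    have htop := Submodule.eq_top_of_finrank_eq (le_antisymm (Submodule.finrank_le _) hg)
    have : g = 1 := Subtype.ext (LinearEquiv.ext fun v => by
      have : v ∈ LinearMap.eqLocus g.1.toLinearMap LinearMap.id := htop ▸ Submodule.mem_top
      exact this)
    exact this ▸ HasNormedLift.one
  | succ n ih =>
    intro g hg
    by_cases h1 : g = 1
    · exact h1 ▸ HasNormedLift.one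
    obtain ⟨s, hs, hfix, v, hv, hsv⟩ := exists_normedLift_agree hq g h1
    rw [← mul_inv_cancel_left s g]
    have hinv : ∀ w, (s⁻¹ * g).1 w = s.1.symm (g.1 w) := fun w => rfl
    refine hs.mul (ih _ ?_)
    have hlt : LinearMap.eqLocus g.1.toLinearMap LinearMap.id <
        LinearMap.eqLocus (s⁻¹ * g).1.toLinearMap LinearMap.id := by
      refine SetLike.lt_iff_le_and_exists.2 ⟨fun w (hw : g.1 w = w) => ?_, v, ?_, hv⟩
      · change (s⁻¹ * g).1 w = w
        rw [hinv, LinearEquiv.symm_apply_eq, hw, hfix w hw]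
      · change (s⁻¹ * g).1 v = v
        rw [hinv, LinearEquiv.symm_apply_eq, hsv]
    have := Submodule.finrank_lt_finrank_of_lt hlt
    omega

end CliffordLifts

/-! ## Semilinear maps of Clifford algebras -/

section CliffordSemilinear

open CliffordAlgebra

variable {K : Type*} [Field K] {W : Type*} [AddCommGroup W] [Module K W] {q : QuadraticForm K W}
  {K' : Type*} [Field K'] {W' : Type*} [AddCommGroup W'] [Module K' W'] {q' : QuadraticForm K' W'}
  {j : K →+* K'} {T : W → W'} {f : CliffordAlgebra q →+* CliffordAlgebra q'}

/-- The semilinear setting covers two cases at once: extension of scalars (`cliffordExt`) and the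
Galois action (`galClifford`). -/
theorem semilinear_involute (hj : ∀ a, f (algebraMap K _ a) = algebraMap K' _ (j a))
    (hT : ∀ w, f (ι q w) = ι q' (T w)) (x : CliffordAlgebra q) :
    f (involute x) = involute (f x) := by
  induction x using CliffordAlgebra.induction with
  | algebraMap r => rw [AlgHom.commutes, hj, AlgHom.commutes]
  | ι w => rw [involute_ι, map_neg, hT, involute_ι]
  | mul a b ha hb => simp only [map_mul, ha, hb]
  | add a b ha hb => simp only [map_add, ha, hb]

theorem semilinear_reverse (hj : ∀ a, f (algebraMap K _ a) = algebraMap K' _ (j a))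
    (hT : ∀ w, f (ι q w) = ι q' (T w)) (x : CliffordAlgebra q) :
    f (reverse x) = reverse (f x) := by
  induction x using CliffordAlgebra.induction with
  | algebraMap r => rw [reverse.commutes, hj, reverse.commutes]
  | ι w => rw [reverse_ι, hT, reverse_ι]
  | mul a b ha hb => simp only [map_mul, reverse.map_mul, ha, hb]
  | add a b ha hb => simp only [map_add, ha, hb]

theorem semilinear_mem_evenOdd (hj : ∀ a, f (algebraMap K _ a) = algebraMap K' _ (j a))
    (hT : ∀ w, f (ι q w) = ι q' (T w)) {x : CliffordAlgebra q} {i : ZMod 2}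
    (hx : x ∈ evenOdd q i) : f x ∈ evenOdd q' i := by
  have hstep : ∀ m₁ m₂ y, f y ∈ evenOdd q' i → f (ι q m₁ * ι q m₂ * y) ∈ evenOdd q' i := by
    intro m₁ m₂ y hy
    rw [map_mul, map_mul, hT, hT, ← zero_add i]
    exact evenOdd_mul_le q' _ _ (Submodule.mul_mem_mul (ι_mul_ι_mem_evenOdd_zero q' _ _) hy)
  have h2 : ∀ i : ZMod 2, i = 0 ∨ i = 1 := by decide
  rcases h2 i with rfl | rfl
  · induction x, hx using CliffordAlgebra.even_induction with
    | algebraMap r =>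
      rw [hj, Algebra.algebraMap_eq_smul_one]
      exact Submodule.smul_mem _ _ (one_le_evenOdd_zero q' (Submodule.one_le.1 le_rfl))
    | add x y hx hy h1 h2 => rw [map_add]; exact Submodule.add_mem _ h1 h2
    | ι_mul_ι_mul m₁ m₂ x hx h => exact hstep _ _ _ h
  · induction x, hx using CliffordAlgebra.odd_induction with
    | ι v => rw [hT]; exact ι_mem_evenOdd_one q' _
    | add x y hx hy h1 h2 => rw [map_add]; exact Submodule.add_mem _ h1 h2
    | ι_mul_ι_mul m₁ m₂ x hx h => exact hstep _ _ _ h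

/-- The conjugation identity is linear in the vector, so it need only be checked on the image of T,
where it is the image under f of the identity for x. -/
theorem IsLift.semilinear (hj : ∀ a, f (algebraMap K _ a) = algebraMap K' _ (j a))
    (hT : ∀ w, f (ι q w) = ι q' (T w)) (hspan : Submodule.span K' (Set.range T) = ⊤)
    {x : cliffordGroup q} {g : orthogonalGroup q} {g' : orthogonalGroup q'} (hx : IsLift q x g)
    (hg : ∀ w, g'.1 (T w) = T (g.1 w)) :
    ∃ y : cliffordGroup q', y.1 = Units.map (f : CliffordAlgebra q →* CliffordAlgebra q') x.1 ∧
      IsLift q' y g' := by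
  obtain ⟨i, hi⟩ := x.2.1
  refine exists_isLift_of_involute_mul _ (i := i) (semilinear_mem_evenOdd hj hT hi) g' fun w => ?_
  change involute (f x.1) * ι q' w = ι q' (g'.1 w) * f x.1
  have hw : w ∈ Submodule.span K' (Set.range T) := hspan ▸ Submodule.mem_top
  induction hw using Submodule.span_induction with
  | mem w hw =>
    obtain ⟨v, rfl⟩ := hw
    rw [hg, ← semilinear_involute hj hT, ← hT, ← hT, ← map_mul, ← map_mul, (isLift_iff x g).1 hx]
  | zero => simp
  | add a b _ _ ha hb => rw [map_add, map_add, map_add, mul_add, add_mul, ha, hb]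
  | smul c a _ ha => rw [map_smul, map_smul, map_smul, mul_smul_comm, smul_mul_assoc, ha]

theorem cliffordNorm_semilinear (hj : ∀ a, f (algebraMap K _ a) = algebraMap K' _ (j a))
    (hT : ∀ w, f (ι q w) = ι q' (T w)) {x : cliffordGroup q} {y : cliffordGroup q'}
    (hy : y.1 = Units.map (f : CliffordAlgebra q →* CliffordAlgebra q') x.1) {a : K}
    (hx : cliffordNorm q x = algebraMap K _ a) : cliffordNorm q' y = algebraMap K' _ (j a) := by
  rw [← hj, ← hx, cliffordNorm, cliffordNorm, hy, map_mul, semilinear_reverse hj hT]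
  rfl

theorem IsDegree.semilinear (hj : ∀ a, f (algebraMap K _ a) = algebraMap K' _ (j a))
    (hT : ∀ w, f (ι q w) = ι q' (T w)) (hspan : Submodule.span K' (Set.range T) = ⊤)
    {g : orthogonalGroup q} {g' : orthogonalGroup q'} {i : ZMod 2} (hi : IsDegree q g i)
    (hg : ∀ w, g'.1 (T w) = T (g.1 w)) : IsDegree q' g' i := by
  obtain ⟨x, hx, hi⟩ := hi
  obtain ⟨y, hy, hyg⟩ := hx.semilinear hj hT hspan hg
  exact ⟨y, hyg, hy ▸ semilinear_mem_evenOdd hj hT hi⟩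

end CliffordSemilinear

/-! ## Extension of scalars -/

section BaseChange

open CliffordAlgebra

variable {F : Type*} [Field F] {V : Type*} [AddCommGroup V] [Module F V]
variable (A : Type*) [Field A] [Algebra F A] (Q : QuadraticForm F V)

/-- The canonical ring homomorphism from the Clifford algebra of `Q` to that of its extension of
scalars. -/
noncomputable def cliffordExt : CliffordAlgebra Q →+* CliffordAlgebra (baseChange A Q) :=
  cliffordLift Q ((algebraMap A (CliffordAlgebra (baseChange A Q))).comp (algebraMap F A))
    (fun a b => Algebra.commutes (algebraMap F A a) b)
    ((ι (baseChange A Q)).toAddMonoidHom.comp (TensorProduct.mk F A V 1).toAddMonoidHom)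
    (fun a w => by
      change ι (baseChange A Q) (1 ⊗ₜ (a • w)) =
        algebraMap A _ (algebraMap F A a) * ι (baseChange A Q) (1 ⊗ₜ w)
      rw [TensorProduct.tmul_smul, ← algebraMap_smul A a, map_smul, Algebra.smul_def])
    (fun w => by
      change ι (baseChange A Q) (1 ⊗ₜ w) * ι (baseChange A Q) (1 ⊗ₜ w) =
        algebraMap A _ (algebraMap F A (Q w))
      rw [ι_sq_scalar, baseChange_one_tmul])

theorem cliffordExt_algebraMap (a : F) :
    cliffordExt A Q (algebraMap F _ a) = algebraMap A _ (algebraMap F A a) := by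
  let j : F →+* CliffordAlgebra (baseChange A Q) :=
    (algebraMap A (CliffordAlgebra (baseChange A Q))).comp (algebraMap F A)
  exact @AlgHom.commutes F (CliffordAlgebra Q) (CliffordAlgebra (baseChange A Q)) _ _ _ _
    (j.toAlgebra' fun a b => Algebra.commutes (algebraMap F A a) b) _ a

theorem cliffordExt_ι (v : V) :
    cliffordExt A Q (ι Q v) = ι (baseChange A Q) (1 ⊗ₜ v) := by
  let j : F →+* CliffordAlgebra (baseChange A Q) :=
    (algebraMap A (CliffordAlgebra (baseChange A Q))).comp (algebraMap F A)
  exact @CliffordAlgebra.lift_ι_apply F _ V _ _ Q (CliffordAlgebra (baseChange A Q)) _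
    (j.toAlgebra' fun a b => Algebra.commutes (algebraMap F A a) b) _ _ v

theorem span_range_one_tmul :
    Submodule.span A (Set.range fun v : V => (1 : A) ⊗ₜ[F] v) = ⊤ := by
  have := Submodule.baseChange_top A (R := F) (M := V)
  rw [← this, Submodule.baseChange_eq_span]
  congr 1
  ext x
  simp

variable {A Q} in
theorem orthogonalBaseChange_tmul (g : orthogonalGroup Q) (a : A) (v : V) :
    (orthogonalBaseChange A Q g).1 (a ⊗ₜ v) = a ⊗ₜ g.1 v := rfl

variable {Q} in
theorem IsLift.cliffordExt {x : cliffordGroup Q} {g : orthogonalGroup Q} (hx : IsLift Q x g) :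
    ∃ y : cliffordGroup (baseChange A Q),
      y.1 = Units.map (cliffordExt A Q : CliffordAlgebra Q →* _) x.1 ∧
        IsLift (baseChange A Q) y (orthogonalBaseChange A Q g) :=
  hx.semilinear (cliffordExt_algebraMap A Q) (cliffordExt_ι A Q) (span_range_one_tmul A)
    fun _ => rfl

variable {Q} in
theorem IsDegree.cliffordExt {g : orthogonalGroup Q} {i : ZMod 2} (hg : IsDegree Q g i) :
    IsDegree (baseChange A Q) (orthogonalBaseChange A Q g) i :=
  hg.semilinear (cliffordExt_algebraMap A Q) (cliffordExt_ι A Q) (span_range_one_tmul A)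
    fun _ => rfl

theorem polar_baseChange_tmul (a b : A) (v w : V) :
    QuadraticMap.polar (baseChange A Q) (a ⊗ₜ v) (b ⊗ₜ w) =
      a * b * algebraMap F A (QuadraticMap.polar Q v w) := by
  have h : ∀ (a : A) (v : V), a ⊗ₜ[F] v = a • (1 ⊗ₜ[F] v) := fun a v => by
    rw [TensorProduct.smul_tmul', smul_eq_mul, mul_one]
  rw [h a, h b, QuadraticMap.polar_smul_left, QuadraticMap.polar_smul_right, QuadraticMap.polar,
    ← TensorProduct.tmul_add, baseChange_one_tmul, baseChange_one_tmul, baseChange_one_tmul,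
    QuadraticMap.polar, map_sub, map_sub, smul_eq_mul, smul_eq_mul, mul_assoc]

variable {Q} in
-- The polar form is symmetric, so one of the two separation conditions suffices.
theorem nondegenerate_polarBilin_iff :
    Q.polarBilin.Nondegenerate ↔ ∀ v, (∀ w, QuadraticMap.polar Q v w = 0) → v = 0 :=
  ⟨fun h => h.1, fun h => ⟨h, fun v hv => h v fun w => by
    rw [QuadraticMap.polar_comm]; exact hv w⟩⟩

variable {Q} in
theorem baseChange_nondegenerate [FiniteDimensional F V] (hQ : Q.polarBilin.Nondegenerate) :
    (baseChange A Q).polarBilin.Nondegenerate := by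
  classical
  rw [nondegenerate_polarBilin_iff]
  intro x hx
  let b := Module.finBasis F V
  let B := Algebra.TensorProduct.basis A b
  refine B.ext_elem fun i => ?_
  have hdual := LinearMap.BilinForm.apply_dualBasis_left (B := Q.polarBilin) hQ b i
  let w := LinearMap.BilinForm.dualBasis Q.polarBilin hQ b i
  -- Pairing with the i-th vector of the dual basis, extended to A, reads off the i-th coordinate.
  -- An x in the radical therefore has all coordinates zero.
  have h : ∀ y, QuadraticMap.polar (baseChange A Q) y (1 ⊗ₜ w) = B.repr y i := by
    intro y
    induction y using TensorProduct.induction_on with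
    | zero => simp [QuadraticMap.polar]
    | add y z hy hz => rw [QuadraticMap.polar_add_left, hy, hz, map_add, Finsupp.add_apply]
    | tmul a v =>
      rw [polar_baseChange_tmul, Algebra.TensorProduct.basis_repr_tmul]
      have : QuadraticMap.polar Q v w = b.repr v i := by
        have h1 : QuadraticMap.polar Q v w = Q.polarBilin w v := QuadraticMap.polar_comm _ _ _
        rw [h1]
        conv_lhs => rw [← b.sum_repr v]
        rw [map_sum]
        refine (Finset.sum_congr rfl fun j _ => (by rw [map_smul, hdual])).trans ?_
        simp
      rw [this, mul_one, Finsupp.smul_apply, Finsupp.mapRange_apply, smul_eq_mul]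
  rw [← h, hx, map_zero, Finsupp.zero_apply]

end BaseChange

/-! ## Factor sets -/

section FactorSets

theorem isLocallyConstant_of_determined {X Y Z : Type*} [TopologicalSpace X] {f : X → Y} {g : X → Z}
    (hf : IsLocallyConstant f) (h : ∀ x y, f x = f y → g x = g y) : IsLocallyConstant g := by
  rw [IsLocallyConstant.iff_exists_open] at hf ⊢
  intro x
  obtain ⟨U, hU, hx, h'⟩ := hf x
  exact ⟨U, hU, hx, fun y hy => h _ _ (h' y hy)⟩

variable {G : Type*} [Group G] [TopologicalSpace G] {M : Type*} [AddCommGroup M]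
  {ρ : G →* AddMonoid.End M} {E : Type*} [Group E] {α : G → E →* E} {i : M → E}

/-- Expanding b_r · r(b_s · s(b_t)) in two ways gives the cocycle identity. Since E carries no
topology, local constancy of the twisted products is a hypothesis. The lemma serves for the Galois
action on Clifford units over Fs and for the trivial action over k. -/
theorem exists_cocycle_of_factorSet [ContinuousMul G]
    (hα : ∀ s t x, α (s * t) x = α s (α t x))
    (hadd : ∀ m n, i (m + n) = i m * i n) (hinj : Function.Injective i)
    (hcent : ∀ m x, i m * x = x * i m) (hequiv : ∀ s m, α s (i m) = i (ρ s m))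
    {b : G → E} (hb : IsLocallyConstant b)
    (hb2 : IsLocallyConstant fun p : G × G => b p.1 * α p.1 (b p.2))
    (h : ∀ s t, ∃ m, b s * α s (b t) = i m * b (s * t)) :
    ∃ z : Z2 ρ, ∀ s t, b s * α s (b t) = i (z.1 (s, t)) * b (s * t) := by
  choose z hz using h
  refine ⟨⟨fun p => z p.1 p.2, ?_, fun r s t => ?_⟩, hz⟩
  · refine isLocallyConstant_of_determined (hb2.prodMk (hb.comp_continuous continuous_mul)) ?_
    rintro ⟨s, t⟩ ⟨s', t'⟩ hst
    obtain ⟨h1, h2⟩ := Prod.mk.inj hst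
    simp only [Function.comp_apply] at h1 h2
    rw [hz, hz, h2] at h1
    exact hinj (mul_right_cancel h1)
  · have h1 : b r * α r (b s * α s (b t)) = i (ρ r (z s t) + z r (s * t)) * b (r * (s * t)) := by
      rw [hz s t, map_mul, hequiv, ← mul_assoc, ← hcent, mul_assoc, hz, hadd, mul_assoc]
    have h2 : b r * α r (b s * α s (b t)) = i (z r s + z (r * s) t) * b (r * (s * t)) := by
      rw [map_mul, ← mul_assoc, hz r s, ← hα, mul_assoc, hz, hadd, mul_assoc, mul_assoc]
    have h3 := hinj (mul_right_cancel (h1.symm.trans h2))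
    change ρ r (z s t) - z (r * s) t + z r (s * t) - z r s = 0
    rw [sub_add_eq_add_sub, h3]
    abel

/-- Multiplying the lifting by central elements c_s changes the factor set by the coboundary of c.
-/
theorem mk_eq_mk_of_factorSet (hadd : ∀ m n, i (m + n) = i m * i n) (hinj : Function.Injective i)
    (hcent : ∀ m x, i m * x = x * i m) (hequiv : ∀ s m, α s (i m) = i (ρ s m))
    {b b' : G → E} (hb : IsLocallyConstant b) (hb' : IsLocallyConstant b')
    (hc : ∀ s, ∃ m, b' s = i m * b s) {z z' : Z2 ρ}
    (hz : ∀ s t, b s * α s (b t) = i (z.1 (s, t)) * b (s * t))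
    (hz' : ∀ s t, b' s * α s (b' t) = i (z'.1 (s, t)) * b' (s * t)) :
    H2.mk z' = H2.mk z := by
  choose c hc using hc
  rw [← sub_eq_zero, ← map_sub]
  refine H2.mk_eq_zero c ?_ fun s t => ?_
  · refine isLocallyConstant_of_determined (hb'.prodMk hb) fun s t hst => ?_
    obtain ⟨h1, h2⟩ := Prod.mk.inj hst
    rw [hc, hc, h2] at h1
    exact hinj (mul_right_cancel h1)
  · have h1 : b' s * α s (b' t) = i (c s + ρ s (c t) + z.1 (s, t)) * b (s * t) := by
      rw [hc, hc, map_mul, hequiv, mul_assoc, ← mul_assoc (b s), ← hcent, mul_assoc, hz, hadd, hadd,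
        mul_assoc, mul_assoc]
    have h2 : b' s * α s (b' t) = i (z'.1 (s, t) + c (s * t)) * b (s * t) := by
      rw [hz', hc, hadd, mul_assoc]
    have h3 := hinj (mul_right_cancel (h2.symm.trans h1))
    change z'.1 (s, t) - z.1 (s, t) = _
    rw [← sub_eq_zero] at h3 ⊢
    rw [← h3]
    abel

end FactorSets

/-! ## Cocycles representing the values of `ξ` -/

section XiCocycle

section Cochains

variable {G : Type*} [Group G] [TopologicalSpace G] {M : Type*} [AddCommGroup M]
  {N : Type*} [AddCommGroup N]

theorem H2.exists_map_mk_eq {ρ : G →* AddMonoid.End M} {ρ' : G →* AddMonoid.End N} (f : M →+ N)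
    (hf : ∀ g m, f (ρ g m) = ρ' g (f m)) (z : Z2 ρ) :
    ∃ w : Z2 ρ', (∀ p, w.1 p = f (z.1 p)) ∧ H2.map f hf (H2.mk z) = H2.mk w :=
  ⟨⟨fun p => f (z.1 p), z.2.1.comp f, fun r s t => by
    rw [← hf, ← map_sub, ← map_add, ← map_sub, z.2.2, map_zero]⟩, fun _ => rfl, rfl⟩

theorem exists_bockstein_eq (χ : H1 G (ZMod 2)) : ∃ z : Z2 (1 : G →* AddMonoid.End ℤ),
    (∀ s t, z.1 (s, t) = carry (χ.1 s) (χ.1 t)) ∧ bockstein χ = H2.mk z :=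
  ⟨_, fun _ _ => rfl, rfl⟩

end Cochains

theorem two_mul_carry (a b : ZMod 2) : 2 * carry a b + (a + b).val = a.val + b.val := by
  revert a b; decide

variable {F : Type*} [Field F] {Fs : Type*} [Field Fs] [Algebra F Fs]

/-- The data n, r, p multiply when tensors are added, so pure tensors suffice. Besides a cocycle for
the Brauer class, the statement records square roots r of representatives n whose factor set is that
same cocycle. The roots are taken in k because in characteristic 2 they may be inseparable over F.
-/
theorem exists_cocycle_pairing (k : Type*) [Field k] [IsAlgClosed k] [Algebra F k]
    (t : H1 Gal(Fs/F) (ZMod 2) ⊗[ℤ] SqClass F) :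
    ∃ (n : Gal(Fs/F) → Fˣ) (p : Gal(Fs/F) → Gal(Fs/F) → Fˣ) (r : Gal(Fs/F) → kˣ)
      (z : Z2 (galUnits F Fs)), IsLocallyConstant n ∧ IsLocallyConstant r ∧
      (∀ σ, SqClass.mk (Additive.ofMul (n σ)) = (cupU Gal(Fs/F) (SqClass.two_nsmul F) t).1 σ) ∧
      (∀ σ, r σ ^ 2 = Units.map (algebraMap F k : F →* k) (n σ)) ∧
      (∀ σ τ, r σ * r τ = Units.map (algebraMap F k : F →* k) (p σ τ) * r (σ * τ)) ∧
      (∀ σ τ, z.1 (σ, τ) = Additive.ofMul (Units.map (algebraMap F Fs : F →* Fs) (p σ τ))) ∧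
      (pairing Fs t : Br F Fs) = H2.mk z := by
  induction t using TensorProduct.induction_on with
  | zero =>
    refine ⟨1, 1, 1, 0, IsLocallyConstant.const 1, IsLocallyConstant.const 1, fun σ => ?_,
      fun σ => by simp, fun σ τ => by simp, fun σ τ => by simp, by
      rw [AddMonoidHom.map_zero, map_zero]; rfl⟩
    rw [AddMonoidHom.map_zero]; exact map_zero _
  | add t t' h h' =>
    obtain ⟨n, p, r, z, hn, hr, h1, h2, h3, h4, h5⟩ := h
    obtain ⟨n', p', r', z', hn', hr', h1', h2', h3', h4', h5'⟩ := h'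
    refine ⟨n * n', p * p', r * r', z + z', hn.mul hn', hr.mul hr', fun σ => ?_, fun σ => ?_,
      fun σ τ => ?_, fun σ τ => ?_, ?_⟩
    · rw [Pi.mul_apply, ofMul_mul, map_add, h1, h1', AddMonoidHom.map_add]; rfl
    · rw [Pi.mul_apply, Pi.mul_apply, mul_pow, h2, h2', map_mul]
    · simp only [Pi.mul_apply, map_mul]
      rw [mul_mul_mul_comm, h3, h3', mul_mul_mul_comm]
    · simp only [Pi.mul_apply, map_mul, AddSubgroup.coe_add, Pi.add_apply, h4, h4', ofMul_mul]
    · rw [AddMonoidHom.map_add, AddSubgroup.coe_add, h5, h5', map_add]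
  | tmul χ u =>
    obtain ⟨b, rfl⟩ : ∃ b : Fˣ, SqClass.mk (Additive.ofMul b) = u := by
      obtain ⟨x, hx⟩ := QuotientAddGroup.mk_surjective u
      exact ⟨x.toMul, hx⟩
    obtain ⟨s₀, hs₀⟩ := IsAlgClosed.exists_pow_nat_eq (algebraMap F k b) two_pos
    have hs0 : s₀ ≠ 0 := by
      rintro rfl
      rw [zero_pow two_ne_zero] at hs₀
      exact b.ne_zero ((map_eq_zero (algebraMap F k)).1 hs₀.symm)
    let s := Units.mk0 s₀ hs0
    have hs : s ^ 2 = Units.map (algebraMap F k : F →* k) b := Units.ext hs₀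
    obtain ⟨z₀, hz₀, hχ⟩ := exists_bockstein_eq χ
    obtain ⟨z, hz, hzz⟩ := H2.exists_map_mk_eq (zmultiplesHom (Additive Fsˣ)
      (Additive.ofMul (Units.map (algebraMap F Fs : F →* Fs) b))) (ρ' := galUnits F Fs) (fun g m => by
        have h : galUnits F Fs g (Additive.ofMul (Units.map (algebraMap F Fs : F →* Fs) b)) =
            Additive.ofMul (Units.map (algebraMap F Fs : F →* Fs) b) := by
          apply Additive.toMul.injective
          ext
          exact g.commutes _
        simp only [MonoidHom.one_apply, AddMonoid.End.coe_one, id_eq, zmultiplesHom_apply,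
          map_zsmul, h]) z₀
    -- For χ ⊗ b the choices are n = b^χ and r = s^χ with s² = b, where χ is lifted to {0, 1}. The
    -- defect χ(σ) + χ(τ) - χ(στ) of the lift is twice the carry, so the factor set of r is b^carry,
    -- which is the cocycle of b ∪ ∂χ.
    refine ⟨fun σ => b ^ (χ.1 σ).val, fun σ τ => b ^ carry (χ.1 σ) (χ.1 τ), fun σ => s ^ (χ.1 σ).val,
      z, χ.2.1.comp fun a : ZMod 2 => b ^ a.val, χ.2.1.comp fun a : ZMod 2 => s ^ a.val,
      fun σ => ?_, fun σ => ?_, fun σ τ => ?_, fun σ τ => ?_, ?_⟩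
    · rw [cupU_tmul, ofMul_pow, map_nsmul]
    · rw [← pow_mul, mul_comm, pow_mul, hs, map_pow]
    · dsimp only
      rw [map_zpow, ← hs, χ.2.2, ← zpow_natCast s, ← zpow_natCast s, ← zpow_natCast s,
        ← zpow_natCast s, ← zpow_mul, ← zpow_add, ← zpow_add]
      congr 1
      exact (two_mul_carry _ _).symm
    · rw [hz, hz₀, zmultiplesHom_apply, map_zpow, ofMul_zpow]
    · rw [← hzz, ← hχ]; rfl

theorem exists_cocycle_xi [IsSepClosure F Fs] (k : Type*) [Field k] [IsAlgClosed k] [Algebra F k]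
    (η : H1 Gal(Fs/F) (SqClass F)) :
    ∃ (n : Gal(Fs/F) → Fˣ) (p : Gal(Fs/F) → Gal(Fs/F) → Fˣ) (r : Gal(Fs/F) → kˣ)
      (z : Z2 (galUnits F Fs)), IsLocallyConstant n ∧ IsLocallyConstant r ∧
      (∀ σ, SqClass.mk (Additive.ofMul (n σ)) = η.1 σ) ∧
      (∀ σ, r σ ^ 2 = Units.map (algebraMap F k : F →* k) (n σ)) ∧
      (∀ σ τ, r σ * r τ = Units.map (algebraMap F k : F →* k) (p σ τ) * r (σ * τ)) ∧
      (∀ σ τ, z.1 (σ, τ) = Additive.ofMul (Units.map (algebraMap F Fs : F →* Fs) (p σ τ))) ∧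
      (xi Fs η : Br F Fs) = H2.mk z := by
  have : IsGalois F Fs := IsSepClosure.isGalois
  have h := exists_cocycle_pairing k ((cupUEquiv Gal(Fs/F) (SqClass.two_nsmul F)).symm η)
  have h1 : cupU Gal(Fs/F) (SqClass.two_nsmul F)
      ((cupUEquiv Gal(Fs/F) (SqClass.two_nsmul F)).symm η) = η :=
    (cupUEquiv Gal(Fs/F) (SqClass.two_nsmul F)).apply_symm_apply η
  rw [h1] at h
  exact h

end XiCocycle

/-! ## The twist of a quadratic space by an orthogonal Galois representation -/

section Descent

variable {F : Type*} [Field F] {Fs : Type*} [Field Fs] [Algebra F Fs]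
  {V : Type*} [AddCommGroup V] [Module F V] {Q : QuadraticForm F V}

theorem tmul_eq_smul_one_tmul {A : Type*} [CommRing A] [Algebra F A] (a : A) (v : V) :
    a ⊗ₜ[F] v = a • (1 ⊗ₜ[F] v) := by
  rw [TensorProduct.smul_tmul', smul_eq_mul, mul_one]

/-- Galois descent via independence of characters. The representation factors through Gal(E/F) with
E finite and normal. A functional ℓ killing the twist kills the averages ∑ τ(a) ⊗ φ(τ)v for all a ∈
E. By Dedekind every coefficient ℓ(1 ⊗ φ(τ)v) vanishes, in particular the one for τ = 1. -/
theorem one_tmul_mem_span_twistedSpace [IsSepClosure F Fs] (φ : Gal(Fs/F) →* orthogonalGroup Q)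
    (hφ : IsOpen (φ.ker : Set Gal(Fs/F))) (v : V) :
    (1 : Fs) ⊗ₜ[F] v ∈ Submodule.span Fs
      (twistedSpace fun σ => orthogonalBaseChange Fs Q (φ σ) : Set (Fs ⊗[F] V)) := by
  have : IsGalois F Fs := IsSepClosure.isGalois
  by_contra hv
  obtain ⟨ℓ, hℓv, hℓ⟩ := Submodule.exists_le_ker_of_notMem hv
  obtain ⟨E, hE, hEn, hEφ⟩ := (krullTopology_mem_nhds_one_iff_of_normal F Fs _).1
    (hφ.mem_nhds (one_mem φ.ker))
  let res : Gal(Fs/F) →* Gal(E/F) := AlgEquiv.restrictNormalHom E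
  -- A set-theoretic section suffices, because φ depends only on the restriction to E (`hker`).
  obtain ⟨sec, hsec⟩ := (AlgEquiv.restrictNormalHom_surjective (F := F) (K₁ := E) Fs).hasRightInverse
  replace hsec : ∀ τ, res (sec τ) = τ := hsec
  have hres : ∀ σ (a : E), (res σ a : Fs) = σ a := fun σ a =>
    AlgEquiv.restrictNormal_commutes σ E a
  have hker : ∀ σ τ, res σ = res τ → φ σ = φ τ := fun σ τ h => by
    have h1 : σ⁻¹ * τ ∈ res.ker := by
      rw [MonoidHom.mem_ker, map_mul, map_inv, h, inv_mul_cancel]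
    rw [IntermediateField.restrictNormalHom_ker] at h1
    have h2 : φ (σ⁻¹ * τ) = 1 := hEφ h1
    rw [map_mul, map_inv, inv_mul_eq_one] at h2
    exact h2
  -- The twisted action of σ permutes the summands by left translation on Gal(E/F).
  have hmem : ∀ a : E, ∑ τ : Gal(E/F), ((τ a : E) : Fs) ⊗ₜ[F] (φ (sec τ)).1 v ∈
      twistedSpace fun σ => orthogonalBaseChange Fs Q (φ σ) := by
    intro a σ
    rw [map_sum, map_sum]
    refine Fintype.sum_equiv (Equiv.mulLeft (res σ)) _ _ fun τ => ?_
    rw [galTensor_tmul, orthogonalBaseChange_tmul, Equiv.coe_mulLeft, AlgEquiv.mul_apply, hres,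
      hker (sec (res σ * τ)) (σ * sec τ) (by rw [map_mul, hsec, hsec]), map_mul]
    rfl
  let toHom : Gal(E/F) → (E →* Fs) := fun τ =>
    (algebraMap E Fs : E →* Fs).comp (τ : E →* E)
  have hinj : Function.Injective toHom := fun σ τ h => AlgEquiv.ext fun a =>
    Subtype.ext (DFunLike.congr_fun h a)
  have hli := (linearIndependent_monoidHom E Fs).comp toHom hinj
  rw [Fintype.linearIndependent_iff] at hli
  have h0 := hli (fun τ => ℓ (1 ⊗ₜ (φ (sec τ)).1 v)) (by
    ext a
    have h1 : ℓ (∑ τ : Gal(E/F), ((τ a : E) : Fs) ⊗ₜ[F] (φ (sec τ)).1 v) = 0 :=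
      hℓ (Submodule.subset_span (hmem a))
    rw [map_sum] at h1
    rw [Finset.sum_apply, Pi.zero_apply, ← h1]
    refine Finset.sum_congr rfl fun τ _ => ?_
    rw [tmul_eq_smul_one_tmul ((τ a : E) : Fs), map_smul, smul_eq_mul, mul_comm]
    rfl) 1
  have h1 : φ (sec 1) = 1 := by rw [hker (sec 1) 1 (by rw [hsec, map_one]), map_one]
  rw [h1] at h0
  exact hℓv h0

/-- An Fs-basis made of twisted vectors is also an F-basis of the twist: the coordinates of a
twisted vector are Galois-invariant, hence lie in F. -/
theorem exists_basis_twistedSpace [IsSepClosure F Fs] [FiniteDimensional F V]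
    (φ : Gal(Fs/F) →* orthogonalGroup Q) (hφ : IsOpen (φ.ker : Set Gal(Fs/F))) :
    ∃ (n : ℕ) (b : Module.Basis (Fin n) F (twistedSpace fun σ => orthogonalBaseChange Fs Q (φ σ)))
      (c : Module.Basis (Fin n) Fs (Fs ⊗[F] V)), ∀ i, c i = (b i).1 := by
  have : IsGalois F Fs := IsSepClosure.isGalois
  let U := twistedSpace fun σ => orthogonalBaseChange Fs Q (φ σ)
  have hspan : Submodule.span Fs (U : Set (Fs ⊗[F] V)) = ⊤ := by
    rw [eq_top_iff, ← span_range_one_tmul (F := F) (V := V) Fs, Submodule.span_le]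
    rintro _ ⟨v, rfl⟩
    exact one_tmul_mem_span_twistedSpace φ hφ v
  obtain ⟨s, hsU, hs, hli⟩ := exists_linearIndependent Fs (U : Set (Fs ⊗[F] V))
  rw [hspan] at hs
  let c₀ : Module.Basis s Fs (Fs ⊗[F] V) := Module.Basis.mk hli (by rw [Subtype.range_coe, hs])
  have : Finite s := Module.Finite.finite_basis c₀
  let e := Finite.equivFin s
  let c := c₀.reindex e
  have hc : ∀ i, c i ∈ U := fun i => by
    have : c i = ((e.symm i : s) : Fs ⊗[F] V) := by
      rw [Module.Basis.reindex_apply, Module.Basis.mk_apply]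
    rw [this]
    exact hsU (e.symm i).2
  have hfix : ∀ v ∈ U, ∀ i, ∃ a : F, algebraMap F Fs a = c.repr v i := by
    intro v hv i
    refine (InfiniteGalois.mem_range_algebraMap_iff_fixed (k := F) _).2 fun σ => ?_
    have h1 := hv σ
    rw [← c.sum_repr v, map_sum, map_sum] at h1
    simp only [galTensor_smul, map_smul, fun i => hc i σ] at h1
    have h2 := congrArg (fun x => c.repr x i) h1
    simpa only [Module.Basis.repr_sum_self] using h2
  let b₀ : Fin _ → U := fun i => ⟨c i, hc i⟩
  have hli : LinearIndependent F b₀ := by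
    have h1 : LinearIndependent F c :=
      c.linearIndependent.restrict_scalars (fun x y hxy => by
        simpa [Algebra.smul_def] using hxy)
    exact LinearIndependent.of_comp U.subtype h1
  refine ⟨_, Module.Basis.mk hli ?_, c, fun i => by rw [Module.Basis.mk_apply]⟩
  rintro ⟨v, hv⟩ -
  choose a ha using hfix v hv
  have h1 : (⟨v, hv⟩ : U) = ∑ i, a i • b₀ i := by
    apply Subtype.ext
    rw [AddSubmonoidClass.coe_finsetSum]
    refine (c.sum_repr v).symm.trans (Finset.sum_congr rfl fun i _ => ?_)
    rw [← ha, algebraMap_smul]; rfl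
  rw [h1]
  exact Submodule.sum_mem _ fun i _ => Submodule.smul_mem _ _ (Submodule.subset_span ⟨i, rfl⟩)

theorem finiteDimensional_twistByRep [IsSepClosure F Fs] [FiniteDimensional F V]
    (φ : Gal(Fs/F) →* orthogonalGroup Q) (hφ : IsOpen (φ.ker : Set Gal(Fs/F))) :
    FiniteDimensional F (TwistByRep φ) := by
  obtain ⟨n, b, -, -⟩ := exists_basis_twistedSpace φ hφ
  exact Module.Finite.of_basis b

/-- The inclusion of the twist in `Fs ⊗ V`. -/
noncomputable def TwistByRep.incl (φ : Gal(Fs/F) →* orthogonalGroup Q) : TwistByRep φ →ₗ[F] Fs ⊗[F] V :=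
  Submodule.subtype (twistedSpace fun σ => orthogonalBaseChange Fs Q (φ σ))

theorem TwistByRep.incl_fixed (φ : Gal(Fs/F) →* orthogonalGroup Q) (σ : Gal(Fs/F))
    (v : TwistByRep φ) :
    (orthogonalBaseChange Fs Q (φ σ)).1 (galTensor V σ (incl φ v)) = incl φ v := v.2 σ

/-- The map is scalar multiplication a ⊗ v ↦ a v. It preserves the forms because a base-changed form
is determined by its values on 1 ⊗ v. -/
theorem exists_twistByRep_isometryEquiv [IsSepClosure F Fs] [FiniteDimensional F V]
    (φ : Gal(Fs/F) →* orthogonalGroup Q) (hφ : IsOpen (φ.ker : Set Gal(Fs/F))) :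
    ∃ m : (baseChange Fs (twistByRep φ)).IsometryEquiv (baseChange Fs Q),
      ∀ a v, m.toLinearEquiv (a ⊗ₜ v) = a • TwistByRep.incl φ v := by
  obtain ⟨n, b, c, hbc⟩ := exists_basis_twistedSpace φ hφ
  let b' : Module.Basis (Fin n) F (TwistByRep φ) := b
  let m : Fs ⊗[F] TwistByRep φ ≃ₗ[Fs] Fs ⊗[F] V :=
    (Algebra.TensorProduct.basis Fs b').equiv c (Equiv.refl _)
  have hm1 : ∀ v, m (1 ⊗ₜ v) = TwistByRep.incl φ v := by
    intro v
    have h : (m.toLinearMap.restrictScalars F).comp (TensorProduct.mk F Fs (TwistByRep φ) 1) =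
        TwistByRep.incl φ := by
      refine b'.ext fun i => ?_
      change m (1 ⊗ₜ b' i) = (b i).1
      rw [← Algebra.TensorProduct.basis_apply, Module.Basis.equiv_apply, Equiv.refl_apply, hbc]
    exact LinearMap.congr_fun h v
  have hq : (baseChange Fs Q).comp m.toLinearMap = baseChange Fs (twistByRep φ) := by
    refine baseChange_unique Fs (twistByRep φ) _ fun v => ?_
    rw [QuadraticMap.comp_apply]
    refine (congrArg (baseChange Fs Q) (hm1 v)).trans ?_
    exact (algebraMap_twistedForm (Q := Q) (fun σ => orthogonalBaseChange Fs Q (φ σ)) v).symm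
  refine ⟨⟨m, fun x => by rw [← hq]; rfl⟩, fun a v => ?_⟩
  change m (a ⊗ₜ v) = _
  rw [tmul_eq_smul_one_tmul, map_smul, hm1]

theorem invCocycle_twistByRep (φ : Gal(Fs/F) →* orthogonalGroup Q)
    (m : (baseChange Fs (twistByRep φ)).IsometryEquiv (baseChange Fs Q))
    (hm : ∀ a v, m.toLinearEquiv (a ⊗ₜ v) = a • TwistByRep.incl φ v) (σ : Gal(Fs/F)) :
    invCocycle m.symm σ = orthogonalBaseChange Fs Q (φ σ) := by
  -- Since twisted vectors are fixed by φ(σ)σ, the map m intertwines σ with φ(σ)σ. The cocycle of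
  -- m⁻¹ is therefore φ.
  have key : ∀ y, m.toLinearEquiv (galTensor _ σ y) =
      (orthogonalBaseChange Fs Q (φ σ)).1 (galTensor V σ (m.toLinearEquiv y)) := by
    intro y
    induction y using TensorProduct.induction_on with
    | zero => simp
    | add x y hx hy => simp only [map_add, hx, hy]
    | tmul a v =>
      rw [galTensor_tmul, hm, hm, galTensor_smul, map_smul, TwistByRep.incl_fixed]
  refine Subtype.ext (LinearEquiv.ext fun x => ?_)
  change m.toLinearEquiv (galTensor _ σ (m.toLinearEquiv.symm (galTensor V σ⁻¹ x))) = _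
  rw [key, LinearEquiv.apply_symm_apply, galTensor_inv_apply]

end Descent

/-! ## Relative Hasse-Witt invariants -/

section HasseWittUnique

open CliffordAlgebra

variable {F : Type*} [Field F] {Fs : Type*} [Field Fs] [Algebra F Fs]
  {V : Type*} [AddCommGroup V] [Module F V] {Q : QuadraticForm F V}
  {V' : Type*} [AddCommGroup V'] [Module F V'] {Q' : QuadraticForm F V'}

theorem galTensor_mul (σ τ : Gal(Fs/F)) (x : Fs ⊗[F] V) :
    galTensor V (σ * τ) x = galTensor V σ (galTensor V τ x) := by
  induction x using TensorProduct.induction_on with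
  | zero => simp
  | add x y hx hy => simp only [map_add, hx, hy]
  | tmul a v => rfl

theorem galClifford_mul (σ τ : Gal(Fs/F)) (x : CliffordAlgebra (baseChange Fs Q)) :
    galClifford Q (σ * τ) x = galClifford Q σ (galClifford Q τ x) := by
  induction x using CliffordAlgebra.induction with
  | algebraMap a => simp only [galClifford_algebraMap]; rfl
  | ι w => simp only [galClifford_ι, galTensor_mul]
  | add x y hx hy => simp only [map_add, hx, hy]
  | mul x y hx hy => simp only [map_mul, hx, hy]

theorem isLocallyConstant_gal_apply [Algebra.IsIntegral F Fs] (a : Fs) :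
    IsLocallyConstant fun σ : Gal(Fs/F) => σ a := by
  rw [IsLocallyConstant.iff_exists_open]
  intro σ
  refine ⟨(fun τ => σ⁻¹ * τ) ⁻¹' (MulAction.stabilizer Gal(Fs/F) a : Set Gal(Fs/F)),
    (stabilizer_isOpen_of_isIntegral a).preimage (continuous_const_mul _), ?_, fun τ hτ => ?_⟩
  · change σ⁻¹ * σ ∈ MulAction.stabilizer Gal(Fs/F) a
    rw [inv_mul_cancel]; exact one_mem _
  · have h : (σ⁻¹ * τ) • a = a := hτ
    rw [mul_smul, inv_smul_eq_iff] at h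
    exact h

theorem isLocallyConstant_galTensor [Algebra.IsIntegral F Fs] (x : Fs ⊗[F] V) :
    IsLocallyConstant fun σ : Gal(Fs/F) => galTensor V σ x := by
  induction x using TensorProduct.induction_on with
  | zero => simp only [map_zero]; exact IsLocallyConstant.const 0
  | add x y hx hy => simp only [map_add]; exact hx.add hy
  | tmul a v => exact (isLocallyConstant_gal_apply a).comp fun b => b ⊗ₜ[F] v

theorem isLocallyConstant_galClifford [Algebra.IsIntegral F Fs]
    (x : CliffordAlgebra (baseChange Fs Q)) :
    IsLocallyConstant fun σ : Gal(Fs/F) => galClifford Q σ x := by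
  induction x using CliffordAlgebra.induction with
  | algebraMap a =>
    simp only [galClifford_algebraMap]
    exact (isLocallyConstant_gal_apply a).comp (algebraMap Fs (CliffordAlgebra (baseChange Fs Q)))
  | ι w =>
    simp only [galClifford_ι]
    exact (isLocallyConstant_galTensor w).comp (ι (baseChange Fs Q))
  | add x y hx hy => simp only [map_add]; exact hx.add hy
  | mul x y hx hy => simp only [map_mul]; exact hx.mul hy

variable (Q) in
/-- The action of the Galois group on the units of the Clifford algebra of `Fs ⊗ V`. -/
noncomputable def galCliffordUnits (σ : Gal(Fs/F)) :
    (CliffordAlgebra (baseChange Fs Q))ˣ →* (CliffordAlgebra (baseChange Fs Q))ˣ :=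
  Units.map (galClifford Q σ : CliffordAlgebra (baseChange Fs Q) →* _)

/-- Near (σ, τ) the element b_τ is constant, and the orbit map of a fixed Clifford element is
locally constant. -/
theorem isLocallyConstant_mul_galCliffordUnits [Algebra.IsIntegral F Fs]
    {b : Gal(Fs/F) → (CliffordAlgebra (baseChange Fs Q))ˣ} (hb : IsLocallyConstant b) :
    IsLocallyConstant fun p : Gal(Fs/F) × Gal(Fs/F) =>
      b p.1 * galCliffordUnits Q p.1 (b p.2) := by
  refine (hb.comp_continuous continuous_fst).mul ?_
  rw [IsLocallyConstant.iff_exists_open]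
  rintro ⟨σ, τ⟩
  obtain ⟨U, hU, hσ, hU'⟩ := (IsLocallyConstant.iff_exists_open _).1
    (isLocallyConstant_galClifford (b τ : CliffordAlgebra (baseChange Fs Q))) σ
  obtain ⟨U₂, hU₂, hτ, hU₂'⟩ := (IsLocallyConstant.iff_exists_open _).1 hb τ
  refine ⟨U ×ˢ U₂, hU.prod hU₂, ⟨hσ, hτ⟩, ?_⟩
  rintro ⟨σ', τ'⟩ ⟨h1, h2⟩
  dsimp only
  rw [hU₂' τ' h2]
  exact Units.ext (hU' σ' h1)

/-- Scalars as units of the Clifford algebra. -/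
def scalarUnits {K W : Type*} [Field K] [AddCommGroup W] [Module K W] (q : QuadraticForm K W)
    (m : Additive Kˣ) : (CliffordAlgebra q)ˣ :=
  Units.map (algebraMap K (CliffordAlgebra q) : K →* CliffordAlgebra q) m.toMul

section ScalarUnits

variable {K W : Type*} [Field K] [AddCommGroup W] [Module K W] {q : QuadraticForm K W}

theorem scalarUnits_add (m n : Additive Kˣ) :
    scalarUnits q (m + n) = scalarUnits q m * scalarUnits q n :=
  map_mul (Units.map (algebraMap K (CliffordAlgebra q) : K →* CliffordAlgebra q)) m.toMul n.toMul

theorem scalarUnits_injective : Function.Injective (scalarUnits q) := fun _ _ h =>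
  Additive.toMul.injective (Units.ext (algebraMap_clifford_injective q (congrArg Units.val h)))

theorem scalarUnits_mul_comm (m : Additive Kˣ) (x : (CliffordAlgebra q)ˣ) :
    scalarUnits q m * x = x * scalarUnits q m :=
  Units.ext (Algebra.commutes _ _)

theorem IsLift.exists_eq_scalarUnits_mul [FiniteDimensional K W] (hq : q.polarBilin.Nondegenerate)
    {x y : cliffordGroup q} {g : orthogonalGroup q} (hx : IsLift q x g) (hy : IsLift q y g) :
    ∃ m, y.1 = scalarUnits q m * x.1 := by
  obtain ⟨c, hc⟩ := hx.exists_eq_mul hq hy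
  exact ⟨Additive.ofMul c, Units.ext hc⟩

end ScalarUnits

theorem galCliffordUnits_scalarUnits (σ : Gal(Fs/F)) (m : Additive Fsˣ) :
    galCliffordUnits Q σ (scalarUnits _ m) = scalarUnits _ (galUnits F Fs σ m) :=
  Units.ext (galClifford_algebraMap Q σ _)

/-- The action of the Galois group on the orthogonal group of `Fs ⊗ V`. -/
noncomputable def galOrthogonal (σ : Gal(Fs/F)) (g : orthogonalGroup (baseChange Fs Q)) :
    orthogonalGroup (baseChange Fs Q) :=
  ⟨{ toFun := fun x => galTensor V σ (g.1 (galTensor V σ⁻¹ x))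
     map_add' := fun x y => by simp only [map_add]
     map_smul' := fun a x => by
      rw [galTensor_smul, map_smul, galTensor_smul, RingHom.id_apply]
      exact congrArg (· • _) (σ.apply_symm_apply a)
     invFun := fun x => galTensor V σ (g.1.symm (galTensor V σ⁻¹ x))
     left_inv := fun x => by
      simp only [galTensor_apply_inv, LinearEquiv.symm_apply_apply, galTensor_inv_apply]
     right_inv := fun x => by
      simp only [galTensor_apply_inv, LinearEquiv.apply_symm_apply, galTensor_inv_apply] },
   fun x => by
    change baseChange Fs Q (galTensor V σ (g.1 (galTensor V σ⁻¹ x))) = _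
    have h : ∀ y, baseChange Fs Q (g.1 y) = baseChange Fs Q y := g.2
    rw [baseChange_galTensor, h, ← baseChange_galTensor, galTensor_inv_apply]⟩

theorem galOrthogonal_galTensor (σ : Gal(Fs/F)) (g : orthogonalGroup (baseChange Fs Q))
    (x : Fs ⊗[F] V) : (galOrthogonal σ g).1 (galTensor V σ x) = galTensor V σ (g.1 x) := by
  change galTensor V σ (g.1 (galTensor V σ⁻¹ (galTensor V σ x))) = _
  rw [galTensor_apply_inv]

theorem span_range_galTensor (σ : Gal(Fs/F)) :
    Submodule.span Fs (Set.range (galTensor V σ)) = ⊤ := by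
  rw [(galTensor V σ).surjective.range_eq, Submodule.span_univ]

theorem IsLift.galOrthogonal {x : cliffordGroup (baseChange Fs Q)}
    {g : orthogonalGroup (baseChange Fs Q)} (hx : IsLift _ x g) (σ : Gal(Fs/F)) :
    ∃ y : cliffordGroup (baseChange Fs Q), y.1 = galCliffordUnits Q σ x.1 ∧
      IsLift _ y (galOrthogonal σ g) :=
  hx.semilinear (j := (σ : Fs →+* Fs)) (galClifford_algebraMap Q σ) (galClifford_ι Q σ)
    (span_range_galTensor σ) (galOrthogonal_galTensor σ g)

theorem IsDegree.galOrthogonal {g : orthogonalGroup (baseChange Fs Q)} {i : ZMod 2}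
    (hg : IsDegree _ g i) (σ : Gal(Fs/F)) : IsDegree _ (galOrthogonal σ g) i :=
  hg.semilinear (j := (σ : Fs →+* Fs)) (galClifford_algebraMap Q σ) (galClifford_ι Q σ)
    (span_range_galTensor σ) (galOrthogonal_galTensor σ g)

theorem invCocycle_apply (u : (baseChange Fs Q).IsometryEquiv (baseChange Fs Q')) (σ : Gal(Fs/F))
    (x : Fs ⊗[F] V) : (invCocycle u σ).1 x =
      u.toLinearEquiv.symm (galTensor V' σ (u.toLinearEquiv (galTensor V σ⁻¹ x))) := rfl

theorem invCocycle_mul (u : (baseChange Fs Q).IsometryEquiv (baseChange Fs Q'))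
    (σ τ : Gal(Fs/F)) :
    invCocycle u (σ * τ) = invCocycle u σ * galOrthogonal σ (invCocycle u τ) := by
  refine Subtype.ext (LinearEquiv.ext fun x => ?_)
  change _ = (invCocycle u σ).1 (galTensor V σ ((invCocycle u τ).1 (galTensor V σ⁻¹ x)))
  rw [invCocycle_apply, invCocycle_apply, galTensor_apply_inv, invCocycle_apply,
    LinearEquiv.apply_symm_apply, galTensor_mul, mul_inv_rev, galTensor_mul]

/-- The vectors 1 ⊗ bᵢ are Galois-fixed, so a_σ is determined by the finitely many vectors σ(u(1 ⊗
bᵢ)), each locally constant in σ. -/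
theorem isLocallyConstant_invCocycle [Algebra.IsIntegral F Fs] [FiniteDimensional F V]
    (u : (baseChange Fs Q).IsometryEquiv (baseChange Fs Q')) :
    IsLocallyConstant (invCocycle u) := by
  let b := Module.finBasis F V
  have h1 : ∀ i, IsLocallyConstant fun σ : Gal(Fs/F) =>
      galTensor V' σ (u.toLinearEquiv (1 ⊗ₜ b i)) := fun i => isLocallyConstant_galTensor _
  have h2 : IsLocallyConstant fun (σ : Gal(Fs/F)) i =>
      galTensor V' σ (u.toLinearEquiv (1 ⊗ₜ b i)) := by
    rw [IsLocallyConstant.iff_eventually_eq]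
    intro σ
    have h := fun i => (IsLocallyConstant.iff_eventually_eq _).1 (h1 i) σ
    filter_upwards [Filter.eventually_all.2 h] with τ hτ
    exact funext hτ
  refine isLocallyConstant_of_determined h2 fun σ τ h => Subtype.ext
    (LinearEquiv.toLinearMap_injective ((Algebra.TensorProduct.basis Fs b).ext fun i => ?_))
  change (invCocycle u σ).1 _ = (invCocycle u τ).1 _
  rw [Algebra.TensorProduct.basis_apply, invCocycle_apply, invCocycle_apply, galTensor_tmul,
    galTensor_tmul, map_one, map_one, congrFun h i]

theorem exists_isDegree {K W : Type*} [Field K] [AddCommGroup W] [Module K W]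
    [FiniteDimensional K W] {q : QuadraticForm K W} (hq : q.polarBilin.Nondegenerate)
    (g : orthogonalGroup q) : ∃ i, IsDegree q g i := by
  obtain ⟨x, -, hx, -⟩ := hasNormedLift hq g
  obtain ⟨i, hi⟩ := x.2.1
  exact ⟨i, x, hx, hi⟩

/-- The identity is restated in the unit group, where the factor-set lemmas apply. -/
theorem isConnecting_iff {a : Gal(Fs/F) → orthogonalGroup (baseChange Fs Q)} {x : Br F Fs} :
    IsConnecting a x ↔ ∃ b : Gal(Fs/F) → cliffordGroup (baseChange Fs Q), IsLocallyConstant b ∧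
      (∀ σ, IsLift _ (b σ) (a σ)) ∧ ∃ z : Z2 (galUnits F Fs), x = H2.mk z ∧ ∀ σ τ,
        (b σ).1 * galCliffordUnits Q σ (b τ).1 = scalarUnits _ (z.1 (σ, τ)) * (b (σ * τ)).1 := by
  refine exists_congr fun b => and_congr_right fun _ => and_congr_right fun _ =>
    exists_congr fun z => and_congr_right fun _ => forall_congr' fun σ => forall_congr' fun τ => ?_
  rw [Units.ext_iff]
  rfl

/-- Composing the cocycle with a lifting chosen once for each group element keeps it locally
constant. The degree is a homomorphism because the Galois action preserves degrees. -/
theorem exists_isHasseWitt [Algebra.IsIntegral F Fs] [FiniteDimensional F V]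
    (hQ : (baseChange Fs Q).polarBilin.Nondegenerate)
    (u : (baseChange Fs Q).IsometryEquiv (baseChange Fs Q')) : ∃ h : BrS F Fs, IsHasseWitt Q Q' h := by
  have ha := isLocallyConstant_invCocycle u
  choose deg hdeg using exists_isDegree hQ
  choose L c hL hc using hasNormedLift hQ
  let b : Gal(Fs/F) → cliffordGroup (baseChange Fs Q) := fun σ => L (invCocycle u σ)
  have hb : IsLocallyConstant b := ha.comp L
  have hb1 : IsLocallyConstant fun σ => (b σ).1 := hb.comp Subtype.val
  obtain ⟨z, hz⟩ := exists_cocycle_of_factorSet (ρ := galUnits F Fs) (α := galCliffordUnits Q)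
    (i := scalarUnits (baseChange Fs Q)) (b := fun σ => (b σ).1)
    (fun s t x => Units.ext (galClifford_mul s t _)) scalarUnits_add scalarUnits_injective
    scalarUnits_mul_comm galCliffordUnits_scalarUnits hb1
    (isLocallyConstant_mul_galCliffordUnits hb1) (fun σ τ => by
      obtain ⟨y, hy, hyl⟩ := (hL (invCocycle u τ)).galOrthogonal σ
      have h1 := (hL (invCocycle u σ)).mul hyl
      rw [← invCocycle_mul] at h1
      obtain ⟨m, hm⟩ := (hL (invCocycle u (σ * τ))).exists_eq_scalarUnits_mul hQ h1
      exact ⟨m, by rw [← hm, ← hy]; rfl⟩)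
  refine ⟨⟨⟨fun σ => deg (invCocycle u σ), ha.comp deg, fun σ τ => ?_⟩, H2.mk z⟩, u,
    fun σ => hdeg _, isConnecting_iff.2 ⟨b, hb, fun σ => hL _, z, rfl, hz⟩⟩
  refine (hdeg _).unique hQ ?_
  rw [invCocycle_mul]
  exact (hdeg _).mul ((hdeg _).galOrthogonal σ)

/-- Two isometries differ by some g, so their cocycles satisfy a'_σ = g⁻¹ a_σ σ(g). The degree of g
enters twice and cancels modulo 2. -/
theorem IsHasseWitt.unique [Algebra.IsIntegral F Fs] [FiniteDimensional F V]
    (hQ : (baseChange Fs Q).polarBilin.Nondegenerate) {h h' : BrS F Fs}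
    (hh : IsHasseWitt Q Q' h) (hh' : IsHasseWitt Q Q' h') : h' = h := by
  obtain ⟨u, hd, hx⟩ := hh
  obtain ⟨u', hd', hx'⟩ := hh'
  let g : orthogonalGroup (baseChange Fs Q) :=
    ⟨u'.toLinearEquiv.trans u.toLinearEquiv.symm, fun w => by
      have h1 : ∀ y, baseChange Fs Q (u.toLinearEquiv.symm y) = baseChange Fs Q' y := fun y =>
        u.symm.map_app y
      have h2 : ∀ y, baseChange Fs Q' (u'.toLinearEquiv y) = baseChange Fs Q y := fun y =>
        u'.map_app y
      rw [LinearEquiv.trans_apply, h1, h2]⟩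
  have hg : ∀ x, u.toLinearEquiv (g.1 x) = u'.toLinearEquiv x := fun x =>
    u.toLinearEquiv.apply_symm_apply _
  have hg' : ∀ x, g.1.symm (u.toLinearEquiv.symm x) = u'.toLinearEquiv.symm x := fun x => by
    rw [LinearEquiv.symm_apply_eq, LinearEquiv.symm_apply_eq, hg, LinearEquiv.apply_symm_apply]
  have hcoc : ∀ σ, invCocycle u' σ = g⁻¹ * invCocycle u σ * galOrthogonal σ g := by
    intro σ
    refine Subtype.ext (LinearEquiv.ext fun x => ?_)
    change _ = g.1.symm ((invCocycle u σ).1 (galTensor V σ (g.1 (galTensor V σ⁻¹ x))))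
    rw [invCocycle_apply, invCocycle_apply, galTensor_apply_inv, hg, hg']
  obtain ⟨b, hb, hbl, z, hxz, hz⟩ := isConnecting_iff.1 hx
  obtain ⟨b', hb', hbl', z', hxz', hz'⟩ := isConnecting_iff.1 hx'
  obtain ⟨x, -, hxg, -⟩ := hasNormedLift hQ g
  obtain ⟨i, hi⟩ := exists_isDegree hQ g
  have hi2 : ∀ i j : ZMod 2, i + j + i = j := by decide
  choose y hy hyl using fun σ : Gal(Fs/F) => hxg.galOrthogonal σ
  -- With x a lift of g, the elements c_σ = x⁻¹ b_σ σ(x) lift a' and have the same factor set as b.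
  -- It remains to compare c with b', two liftings of the same cocycle.
  let c : Gal(Fs/F) → cliffordGroup (baseChange Fs Q) := fun σ => x⁻¹ * b σ * y σ
  have hcl : ∀ σ, IsLift _ (c σ) (invCocycle u' σ) := fun σ => by
    rw [hcoc]; exact (hxg.inv.mul (hbl σ)).mul (hyl σ)
  have hc1 : ∀ σ, (c σ).1 = x.1⁻¹ * (b σ).1 * galCliffordUnits Q σ x.1 := fun σ => by
    rw [← hy]; rfl
  have hxc : IsLocallyConstant fun σ => galCliffordUnits Q σ x.1 :=
    isLocallyConstant_of_determined 
      (isLocallyConstant_galClifford (x.1 : CliffordAlgebra (baseChange Fs Q)))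
      fun σ τ h => Units.ext h
  have hcc : IsLocallyConstant fun σ => (c σ).1 := by
    simp only [hc1]
    exact ((IsLocallyConstant.const x.1⁻¹).mul (hb.comp Subtype.val)).mul hxc
  have hcz : ∀ σ τ, (c σ).1 * galCliffordUnits Q σ (c τ).1 =
      scalarUnits _ (z.1 (σ, τ)) * (c (σ * τ)).1 := by
    intro σ τ
    have h1 : galCliffordUnits Q (σ * τ) x.1 =
        galCliffordUnits Q σ (galCliffordUnits Q τ x.1) := Units.ext (galClifford_mul σ τ _)
    simp only [hc1, map_mul, map_inv, h1]
    have h2 : scalarUnits _ (z.1 (σ, τ)) * (x.1⁻¹ * (b (σ * τ)).1 *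
          galCliffordUnits Q σ (galCliffordUnits Q τ x.1)) =
        x.1⁻¹ * (scalarUnits _ (z.1 (σ, τ)) * (b (σ * τ)).1) *
          galCliffordUnits Q σ (galCliffordUnits Q τ x.1) := by
      rw [← mul_assoc, ← mul_assoc, scalarUnits_mul_comm, mul_assoc x.1⁻¹]
    rw [h2, ← hz]
    group
  apply BrS.ext
  · refine Subtype.ext (funext fun σ => (hd' σ).unique hQ ?_)
    rw [hcoc, ← hi2 i (h.fst.1 σ)]
    exact (hi.inv.mul (hd σ)).mul (hi.galOrthogonal σ)
  · rw [hxz, hxz']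
    exact mk_eq_mk_of_factorSet (α := galCliffordUnits Q) (i := scalarUnits (baseChange Fs Q))
      (b := fun σ => (c σ).1) (b' := fun σ => (b' σ).1) scalarUnits_add scalarUnits_injective
      scalarUnits_mul_comm galCliffordUnits_scalarUnits hcc (hb'.comp Subtype.val)
      (fun σ => (hcl σ).exists_eq_scalarUnits_mul hQ (hbl' σ)) hcz hz'

end HasseWittUnique

/-! ## Spinor norms -/

section SpinorNormUnique

open CliffordAlgebra

variable {K : Type*} [Field K] {W : Type*} [AddCommGroup W] [Module K W] {q : QuadraticForm K W}

theorem exists_scalar_mem_cliffordGroup (q : QuadraticForm K W) (m : Additive Kˣ) :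
    ∃ s : cliffordGroup q, s.1 = scalarUnits q m ∧ IsLift q s 1 ∧
      cliffordNorm q s = algebraMap K _ ((m.toMul : K) ^ 2) := by
  have h : (scalarUnits q m : CliffordAlgebra q) = algebraMap K _ (m.toMul : K) := rfl
  obtain ⟨s, hs, hl⟩ := exists_isLift_of_involute_mul (scalarUnits q m) (i := 0) (by
    rw [h, Algebra.algebraMap_eq_smul_one]
    exact Submodule.smul_mem _ _ (one_le_evenOdd_zero q (Submodule.one_le.1 le_rfl))) 1 (fun w => by
    rw [h, AlgHom.commutes, algebraMap_mul_comm_clifford]; rfl)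
  refine ⟨s, hs, hl, ?_⟩
  rw [cliffordNorm, hs, h, reverse.commutes, ← map_mul, sq]

theorem cliffordNorm_scalarUnits_mul {x y : cliffordGroup q} {m : Additive Kˣ} {a : K}
    (hy : y.1 = scalarUnits q m * x.1) (hx : cliffordNorm q x = algebraMap K _ a) :
    cliffordNorm q y = algebraMap K _ ((m.toMul : K) ^ 2 * a) := by
  obtain ⟨s, hs, -, hn⟩ := exists_scalar_mem_cliffordGroup q m
  have : y = s * x := Subtype.ext (by rw [hy, ← hs]; rfl)
  rw [this]
  exact cliffordNorm_mul hn hx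

variable [FiniteDimensional K W]

/-- Two lifts differ by a scalar m, and their norms by m². -/
theorem existsUnique_isSpinorNorm (hq : q.polarBilin.Nondegenerate) (g : orthogonalGroup q) :
    ∃! c, IsSpinorNorm q g c := by
  obtain ⟨x, a, hx, ha⟩ := hasNormedLift hq g
  refine ⟨_, ⟨x, a, hx, ha, rfl⟩, ?_⟩
  rintro _ ⟨y, b, hy, hb, rfl⟩
  obtain ⟨m, hm⟩ := hx.exists_eq_scalarUnits_mul hq hy
  have h1 : b = m.toMul ^ 2 * a := Units.ext (algebraMap_clifford_injective q
    (hb.symm.trans (cliffordNorm_scalarUnits_mul hm ha)))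
  have h2 : (SqClass.mk (Additive.ofMul (m.toMul ^ 2)) : SqClass K) = 0 := by
    rw [ofMul_pow, map_nsmul, SqClass.two_nsmul]
  rw [h1, ofMul_mul, map_add, h2, zero_add]

theorem isSpinorNorm_spinorNorm (hq : q.polarBilin.Nondegenerate) (g : orthogonalGroup q) :
    IsSpinorNorm q g (spinorNorm q g) :=
  Classical.epsilon_spec (existsUnique_isSpinorNorm hq g).exists

theorem spinorNorm_mul (hq : q.polarBilin.Nondegenerate) (g h : orthogonalGroup q) :
    spinorNorm q (g * h) = spinorNorm q g + spinorNorm q h := by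
  obtain ⟨x, a, hx, ha, hxa⟩ := isSpinorNorm_spinorNorm hq g
  obtain ⟨y, b, hy, hb, hyb⟩ := isSpinorNorm_spinorNorm hq h
  refine (existsUnique_isSpinorNorm hq (g * h)).unique (isSpinorNorm_spinorNorm hq _)
    ⟨x * y, a * b, hx.mul hy, ?_, ?_⟩
  · rw [Units.val_mul]; exact cliffordNorm_mul ha hb
  · rw [hxa, hyb, ofMul_mul, map_add]

/-- Rescaling a lift realises every representative of the spinor norm. This allows the
representatives to be dictated by the cocycle of ξ. -/
theorem exists_isLift_norm_eq (hq : q.polarBilin.Nondegenerate) (g : orthogonalGroup q) (n : Kˣ)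
    (hn : SqClass.mk (Additive.ofMul n) = spinorNorm q g) :
    ∃ x, IsLift q x g ∧ cliffordNorm q x = algebraMap K _ (n : K) := by
  obtain ⟨x, a, hx, ha, hxa⟩ := isSpinorNorm_spinorNorm hq g
  rw [hxa] at hn
  obtain ⟨m, hm⟩ : ∃ m : Additive Kˣ, 2 • m = -Additive.ofMul a + Additive.ofMul n :=
    AddMonoidHom.mem_range.1 (QuotientAddGroup.eq.1 hn.symm)
  obtain ⟨s, hs, hsl, hsn⟩ := exists_scalar_mem_cliffordGroup q m
  have hna : (n : K) = (m.toMul : K) ^ 2 * a := by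
    have h1 : Additive.ofMul n = 2 • m + Additive.ofMul a := by rw [hm]; abel
    exact congrArg (fun t : Additive Kˣ => (t.toMul : K)) h1
  refine ⟨s * x, ?_, ?_⟩
  · simpa using hsl.mul hx
  · rw [hna]; exact cliffordNorm_mul hsn ha

end SpinorNormUnique

/-! ## Stiefel-Whitney classes -/

section StiefelWhitneyUnique

theorem isLocallyConstant_of_isOpen_ker {G H : Type*} [Group G] [TopologicalSpace G]
    [ContinuousMul G] [Group H] (φ : G →* H) (hφ : IsOpen (φ.ker : Set G)) :
    IsLocallyConstant φ := by
  rw [IsLocallyConstant.iff_exists_open]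
  intro s
  refine ⟨(fun t => s⁻¹ * t) ⁻¹' φ.ker, hφ.preimage (continuous_const_mul _), ?_, fun t ht => ?_⟩
  · change s⁻¹ * s ∈ φ.ker
    rw [inv_mul_cancel]; exact one_mem _
  · have h : φ (s⁻¹ * t) = 1 := ht
    rw [map_mul, map_inv, inv_mul_eq_one] at h
    exact h.symm

theorem zmod_two_cases : ∀ i : ZMod 2, i = 0 ∨ i = 1 := by decide

theorem sgn_injective {K : Type*} [Field K] (h : (2 : K) ≠ 0) : Function.Injective (sgn K) := by
  rw [injective_iff_map_eq_zero]
  intro i hi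
  rcases zmod_two_cases i with rfl | rfl
  · rfl
  · rw [sgn_one] at hi
    have h1 : (-1 : K) = 1 := congrArg (fun t : Additive Kˣ => (t.toMul : K)) hi
    refine (h ?_).elim
    linear_combination -h1

theorem exists_sgn_eq {K : Type*} [Field K] (m : Additive Kˣ) (hm : (m.toMul : K) ^ 2 = 1) :
    ∃ i, sgn K i = m := by
  rcases sq_eq_one_iff.1 hm with h | h
  · exact ⟨0, by rw [map_zero]; exact Additive.toMul.injective (Units.ext h.symm)⟩
  · exact ⟨1, by rw [sgn_one]; exact Additive.toMul.injective (Units.ext h.symm)⟩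

theorem map_sgn {K L : Type*} [Field K] [Field L] (f : K →+* L) (i : ZMod 2) :
    Units.map (f : K →* L) (sgn K i).toMul = (sgn L i).toMul := by
  rcases zmod_two_cases i with rfl | rfl
  · simp
  · rw [sgn_one, sgn_one]
    ext
    simp

variable {K : Type*} [Field K] {W : Type*} [AddCommGroup W] [Module K W] {q : QuadraticForm K W}

/-- The ratio of two lifts is a scalar, and both have norm 1, so its square is 1. -/
theorem exists_sgn_mul_of_pin [FiniteDimensional K W] (hq : q.polarBilin.Nondegenerate)
    {x y : pin q} {g : orthogonalGroup q} (hx : IsLift q x.1 g) (hy : IsLift q y.1 g) :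
    ∃ i, y.1.1 = scalarUnits q (sgn K i) * x.1.1 := by
  obtain ⟨m, hm⟩ := hx.exists_eq_scalarUnits_mul hq hy
  have hx1 : cliffordNorm q x.1 = algebraMap K _ 1 := by rw [map_one]; exact x.2
  have hy1 : cliffordNorm q y.1 = algebraMap K _ 1 := by rw [map_one]; exact y.2
  have h1 := algebraMap_clifford_injective q
    ((cliffordNorm_scalarUnits_mul hm hx1).symm.trans hy1)
  rw [mul_one] at h1
  obtain ⟨i, rfl⟩ := exists_sgn_eq m h1
  exact ⟨i, hm⟩

variable {G : Type*} [Group G] [TopologicalSpace G]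

theorem IsStiefelWhitney.unique [FiniteDimensional K W] (hq : q.polarBilin.Nondegenerate)
    {ψ : G →* orthogonalGroup q} {c c' : H1 G (ZMod 2) × H2 (1 : G →* AddMonoid.End (ZMod 2))}
    (hc : IsStiefelWhitney q ψ c) (hc' : IsStiefelWhitney q ψ c') : c' = c := by
  obtain ⟨hd, hb⟩ := hc
  obtain ⟨hd', hb'⟩ := hc'
  have h1 : c'.1 = c.1 := Subtype.ext (funext fun s => (hd' s).unique hq (hd s))
  refine Prod.ext h1 ?_
  by_cases h2 : (2 : K) = 0
  · rw [hb.2 h2, hb'.2 h2]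
  obtain ⟨b, hb, hbl, z, hz, hbz⟩ := hb.1 h2
  obtain ⟨b', hb', hbl', z', hz', hbz'⟩ := hb'.1 h2
  have h3 : ∀ s t, (b s).1.1 * (b t).1.1 =
      scalarUnits q (sgn K (z.1 (s, t))) * (b (s * t)).1.1 := fun s t => Units.ext (hbz s t)
  have h4 : ∀ s t, (b' s).1.1 * (b' t).1.1 =
      scalarUnits q (sgn K (z'.1 (s, t))) * (b' (s * t)).1.1 := fun s t => Units.ext (hbz' s t)
  have h5 := fun s => exists_sgn_mul_of_pin hq (hbl s) (hbl' s)
  have h6 : IsLocallyConstant fun s => (b s).1.1 := hb.comp fun x : pin q => x.1.1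
  have h7 : IsLocallyConstant fun s => (b' s).1.1 := hb'.comp fun x : pin q => x.1.1
  rw [hz, hz']
  have hadd : ∀ m n, scalarUnits q (sgn K (m + n)) =
      scalarUnits q (sgn K m) * scalarUnits q (sgn K n) := fun m n => by
    rw [map_add, scalarUnits_add]
  have hinj : Function.Injective fun m => scalarUnits q (sgn K m) :=
    scalarUnits_injective.comp (sgn_injective h2)
  exact mk_eq_mk_of_factorSet (ρ := (1 : G →* AddMonoid.End (ZMod 2)))
    (α := fun _ => MonoidHom.id (CliffordAlgebra q)ˣ) (i := fun m => scalarUnits q (sgn K m))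
    (b := fun s => (b s).1.1) (b' := fun s => (b' s).1.1) hadd hinj
    (fun m => scalarUnits_mul_comm _) (fun _ _ => rfl) h6 h7 h5 h3 h4

end StiefelWhitneyUnique

/-! ## Comparison of the invariants -/

section Comparison

open CliffordAlgebra

variable {F : Type*} [Field F] {Fs : Type*} [Field Fs] [Algebra F Fs]
  {V : Type*} [AddCommGroup V] [Module F V] {Q : QuadraticForm F V}

theorem galClifford_cliffordExt (σ : Gal(Fs/F)) (x : CliffordAlgebra Q) :
    galClifford Q σ (cliffordExt Fs Q x) = cliffordExt Fs Q x := by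
  induction x using CliffordAlgebra.induction with
  | algebraMap a => rw [cliffordExt_algebraMap, galClifford_algebraMap, σ.commutes]
  | ι v => rw [cliffordExt_ι, galClifford_ι, galTensor_tmul, map_one]
  | add x y hx hy => rw [map_add, map_add, hx, hy]
  | mul x y hx hy => rw [map_mul, map_mul, hx, hy]

variable (Q) in
/-- Extension of scalars on units of Clifford algebras. -/
noncomputable def cliffordExtUnits (A : Type*) [Field A] [Algebra F A] :
    (CliffordAlgebra Q)ˣ →* (CliffordAlgebra (baseChange A Q))ˣ :=
  Units.map (cliffordExt A Q : CliffordAlgebra Q →* CliffordAlgebra (baseChange A Q))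

theorem cliffordExtUnits_scalarUnits (A : Type*) [Field A] [Algebra F A] (m : Additive Fˣ) :
    cliffordExtUnits Q A (scalarUnits Q m) = scalarUnits (baseChange A Q)
      (Additive.ofMul (Units.map (algebraMap F A : F →* A) m.toMul)) :=
  Units.ext (cliffordExt_algebraMap A Q _)

theorem exists_locallyConstant_lift_ext (A : Type*) [Field A] [Algebra F A]
    {G : Type*} [TopologicalSpace G] {b : G → cliffordGroup Q} (hb : IsLocallyConstant b)
    {g : G → orthogonalGroup Q} (hbg : ∀ s, IsLift Q (b s) (g s)) :
    ∃ b' : G → cliffordGroup (baseChange A Q), IsLocallyConstant b' ∧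
      (∀ s, (b' s).1 = cliffordExtUnits Q A (b s).1) ∧
        ∀ s, IsLift (baseChange A Q) (b' s) (orthogonalBaseChange A Q (g s)) := by
  choose b' h1 h2 using fun s => (hbg s).cliffordExt A
  exact ⟨b', isLocallyConstant_of_determined hb fun s t h => Subtype.ext (by rw [h1, h1, h]), h1, h2⟩

/-- The lift is chosen as a function of the pair (g, n), so it inherits local constancy from g and
n. Incompatible pairs receive the value 1. -/
theorem exists_locallyConstant_normedLift [FiniteDimensional F V]
    (hQ : Q.polarBilin.Nondegenerate) {G : Type*} [TopologicalSpace G]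
    {g : G → orthogonalGroup Q} (hg : IsLocallyConstant g) {n : G → Fˣ} (hn : IsLocallyConstant n)
    (h : ∀ s, SqClass.mk (Additive.ofMul (n s)) = spinorNorm Q (g s)) :
    ∃ b : G → cliffordGroup Q, IsLocallyConstant b ∧ (∀ s, IsLift Q (b s) (g s)) ∧
      ∀ s, cliffordNorm Q (b s) = algebraMap F _ (n s : F) := by
  have key : ∀ p : orthogonalGroup Q × Fˣ, ∃ x : cliffordGroup Q,
      SqClass.mk (Additive.ofMul p.2) = spinorNorm Q p.1 →
        IsLift Q x p.1 ∧ cliffordNorm Q x = algebraMap F _ (p.2 : F) := fun p => by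
    by_cases hp : SqClass.mk (Additive.ofMul p.2) = spinorNorm Q p.1
    · obtain ⟨x, hx⟩ := exists_isLift_norm_eq hQ p.1 p.2 hp
      exact ⟨x, fun _ => hx⟩
    · exact ⟨1, fun h => (hp h).elim⟩
  choose L hL using key
  exact ⟨fun s => L (g s, n s), (hg.prodMk hn).comp L, fun s => (hL (g s, n s) (h s)).1,
    fun s => (hL (g s, n s) (h s)).2⟩

theorem spinorNorm_comp_mem_H1 [FiniteDimensional F V] (hQ : Q.polarBilin.Nondegenerate)
    {G : Type*} [Group G] [TopologicalSpace G] [ContinuousMul G] (φ : G →* orthogonalGroup Q)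
    (hφ : IsOpen (φ.ker : Set G)) : (fun σ => spinorNorm Q (φ σ)) ∈ H1 G (SqClass F) :=
  ⟨(isLocallyConstant_of_isOpen_ker φ hφ).comp (spinorNorm Q),
    fun s t => by dsimp only; rw [map_mul, spinorNorm_mul hQ]⟩

theorem exists_degree_mem_H1 [FiniteDimensional F V] (hQ : Q.polarBilin.Nondegenerate)
    {G : Type*} [Group G] [TopologicalSpace G] [ContinuousMul G] (φ : G →* orthogonalGroup Q)
    (hφ : IsOpen (φ.ker : Set G)) : ∃ d : H1 G (ZMod 2), ∀ s, IsDegree Q (φ s) (d.1 s) := by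
  choose deg hdeg using exists_isDegree hQ
  refine ⟨⟨fun s => deg (φ s), (isLocallyConstant_of_isOpen_ker φ hφ).comp deg, fun s t => ?_⟩,
    fun s => hdeg _⟩
  dsimp only
  rw [map_mul]
  exact (hdeg _).unique hQ ((hdeg _).mul (hdeg _))

/-- Given lifts `b` of an orthogonal representation with norms `n = r²` over the algebraically
closed field `k` and `b_s b_t = y(s,t) b_{st}`, `r_s r_t = p(s,t) r_{st}`, the second
Stiefel-Whitney class is represented by a cocycle `z` with `y = (-1)^z p`. -/
theorem exists_isSW2 [FiniteDimensional F V] (hQ : Q.polarBilin.Nondegenerate)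
    (k : Type*) [Field k] [Algebra F k]
    {G : Type*} [Group G] [TopologicalSpace G] [ContinuousMul G] (φ : G →* orthogonalGroup Q)
    {b : G → cliffordGroup Q} (hb : IsLocallyConstant b) (hbφ : ∀ s, IsLift Q (b s) (φ s))
    {n : G → Fˣ} (hbn : ∀ s, cliffordNorm Q (b s) = algebraMap F _ (n s : F))
    {y p : G → G → Fˣ} (hy : ∀ s t, (b s).1 * (b t).1 =
      scalarUnits Q (Additive.ofMul (y s t)) * (b (s * t)).1)
    {r : G → kˣ} (hr : IsLocallyConstant r)
    (hrn : ∀ s, r s ^ 2 = Units.map (algebraMap F k : F →* k) (n s))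
    (hrp : ∀ s t, r s * r t = Units.map (algebraMap F k : F →* k) (p s t) * r (s * t)) :
    ∃ z : Z2 (1 : G →* AddMonoid.End (ZMod 2)),
      IsSW2 _ ((orthogonalBaseChange k Q).comp φ) (H2.mk z) ∧
        ∀ s t, y s t = (sgn F (z.1 (s, t))).toMul * p s t := by
  have hinjk : Function.Injective (Units.map (algebraMap F k : F →* k)) :=
    Units.map_injective (algebraMap F k).injective
  by_cases h2 : (2 : k) = 0
  -- In characteristic 2 signs are trivial, and the claim is y = p. Taking norms of the relation for
  -- b, and squaring the one for r, gives y² n_{st} = n_s n_t = p² n_{st}.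
  · refine ⟨0, ⟨fun h => (h h2).elim, fun _ => map_zero _⟩, fun s t => ?_⟩
    change y s t = (sgn F 0).toMul * p s t
    rw [map_zero, toMul_zero, one_mul]
    have hyn : y s t ^ 2 * n (s * t) = n s * n t := by
      have h1 := cliffordNorm_scalarUnits_mul (x := b (s * t)) (y := b s * b t) (hy s t)
        (hbn (s * t))
      have h3 := cliffordNorm_mul (hbn s) (hbn t)
      exact Units.ext (algebraMap_clifford_injective Q (h1.symm.trans h3))
    have hpn : p s t ^ 2 * n (s * t) = n s * n t := by
      apply hinjk
      rw [map_mul, map_mul, map_pow, ← hrn, ← hrn, ← hrn, ← mul_pow, ← mul_pow, hrp]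
    have hyp := mul_right_cancel (hyn.trans hpn.symm)
    have h2F : (2 : F) = 0 := (algebraMap F k).injective (by rw [map_ofNat, map_zero, h2])
    have hyp' : (y s t : F) ^ 2 = (p s t : F) ^ 2 := congrArg Units.val hyp
    rcases sq_eq_sq_iff_eq_or_eq_neg.1 hyp' with h | h
    · exact Units.ext h
    · refine Units.ext (h.trans ?_)
      linear_combination -(p s t : F) * h2F
  · have hk := baseChange_nondegenerate k hQ
    obtain ⟨e, he, heb, hel⟩ := exists_locallyConstant_lift_ext k hb hbφ
    choose sc hsc hsc1 hscn using exists_scalar_mem_cliffordGroup (baseChange k Q)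
    let R : G → Additive kˣ := fun s => Additive.ofMul (r s)
    have hen : ∀ s, cliffordNorm _ (e s) = algebraMap k _ (algebraMap F k (n s)) := fun s =>
      cliffordNorm_semilinear (cliffordExt_algebraMap k Q) (cliffordExt_ι k Q) (heb s) (hbn s)
    -- The normalised lifts r_s⁻¹ b_s have norm r_s⁻² n_s = 1.
    have hc1 : ∀ s, cliffordNorm _ (sc (-R s) * e s) = 1 := fun s => by
      refine (cliffordNorm_mul (hscn _) (hen s)).trans ?_
      have h3 : (((-R s).toMul : kˣ) : k) ^ 2 * algebraMap F k (n s) = 1 := by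
        have h4 : (r s)⁻¹ ^ 2 * Units.map (algebraMap F k : F →* k) (n s) = 1 := by
          rw [← hrn, ← mul_pow, inv_mul_cancel, one_pow]
        exact congrArg Units.val h4
      rw [h3, map_one]
    let c : G → pin (baseChange k Q) := fun s => ⟨sc (-R s) * e s, hc1 s⟩
    have hcl : ∀ s, IsLift _ (c s).1 (orthogonalBaseChange k Q (φ s)) := fun s => by
      simpa using (hsc1 (-R s)).mul (hel s)
    have hcu : ∀ s, (c s).1.1 = scalarUnits _ (-R s) * cliffordExtUnits Q k (b s).1 := fun s => by
      rw [← hsc, ← heb]; rfl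
    have hclc : IsLocallyConstant c := isLocallyConstant_of_determined (he.prodMk hr)
      fun s t hst => by
        obtain ⟨h3, h4⟩ := Prod.mk.inj hst
        refine Subtype.ext ?_
        change sc (-R s) * e s = sc (-R t) * e t
        simp only [R, h3, h4]
    have hcc : IsLocallyConstant fun s => (c s).1.1 :=
      hclc.comp fun x : pin (baseChange k Q) => x.1.1
    have hadd : ∀ m n, scalarUnits (baseChange k Q) (sgn k (m + n)) =
        scalarUnits _ (sgn k m) * scalarUnits _ (sgn k n) := fun m n => by
      rw [map_add, scalarUnits_add]
    have hinj : Function.Injective fun m => scalarUnits (baseChange k Q) (sgn k m) :=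
      scalarUnits_injective.comp (sgn_injective h2)
    obtain ⟨z, hz⟩ := exists_cocycle_of_factorSet (ρ := (1 : G →* AddMonoid.End (ZMod 2)))
      (α := fun _ => MonoidHom.id (CliffordAlgebra (baseChange k Q))ˣ)
      (i := fun m => scalarUnits (baseChange k Q) (sgn k m)) (b := fun s => (c s).1.1)
      (fun _ _ _ => rfl) hadd hinj (fun m => scalarUnits_mul_comm _) (fun _ _ => rfl) hcc
      ((hcc.comp_continuous continuous_fst).mul (hcc.comp_continuous continuous_snd))
      (fun s t => by
        have h3 := (hcl s).mul (hcl t)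
        rw [← map_mul, ← map_mul] at h3
        exact exists_sgn_mul_of_pin (y := c s * c t) hk (hcl (s * t)) h3)
    replace hz : ∀ s t, (c s).1.1 * (c t).1.1 =
      scalarUnits _ (sgn k (z.1 (s, t))) * (c (s * t)).1.1 := hz
    refine ⟨z, ⟨fun _ => ⟨c, hclc, hcl, z, rfl, fun s t => congrArg Units.val (hz s t)⟩,
      fun h => (h2 h).elim⟩, fun s t => ?_⟩
    -- Both sides equal c_s c_t: one via the factor set y of b, the other via the sign cocycle z of
    -- c. Cancelling the common unit leaves an identity of scalars.
    have h3 : scalarUnits (baseChange k Q) (-R s + -R t +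
          Additive.ofMul (Units.map (algebraMap F k : F →* k) (y s t))) *
            cliffordExtUnits Q k (b (s * t)).1 =
        scalarUnits _ (sgn k (z.1 (s, t)) + -R (s * t)) * cliffordExtUnits Q k (b (s * t)).1 := by
      have h4 : cliffordExtUnits Q k (b s).1 * cliffordExtUnits Q k (b t).1 =
          scalarUnits _ (Additive.ofMul (Units.map (algebraMap F k : F →* k) (y s t))) *
            cliffordExtUnits Q k (b (s * t)).1 := by
        rw [← map_mul, hy, map_mul, cliffordExtUnits_scalarUnits, toMul_ofMul]
      rw [scalarUnits_add, scalarUnits_add, scalarUnits_add, mul_assoc, ← h4,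
        mul_assoc (scalarUnits _ (sgn k _)), ← hcu, ← hz, hcu, hcu, mul_assoc, mul_assoc,
        ← mul_assoc (scalarUnits _ (-R t)), ← mul_assoc (cliffordExtUnits Q k _),
        ← scalarUnits_mul_comm (-R t) (cliffordExtUnits Q k (b s).1)]
    have h4 := scalarUnits_injective (mul_right_cancel h3)
    apply hinjk
    rw [map_mul, map_sgn (algebraMap F k)]
    have h5 : R s + R t = Additive.ofMul (Units.map (algebraMap F k : F →* k) (p s t)) +
      R (s * t) := congrArg Additive.ofMul (hrp s t)
    have h6 : Additive.ofMul (Units.map (algebraMap F k : F →* k) (y s t)) =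
        sgn k (z.1 (s, t)) + Additive.ofMul (Units.map (algebraMap F k : F →* k) (p s t)) := by
      rw [eq_sub_of_add_eq h5.symm]
      have h7 := congrArg (fun x => R s + R t + x) h4
      rw [← sub_eq_zero] at h7 ⊢
      rw [← h7]
      abel
    exact congrArg Additive.toMul h6

/-- Lifts defined over F are Galois-fixed, so their twisted factor set is the ordinary one. -/
theorem isConnecting_of_factorSet {a : Gal(Fs/F) → orthogonalGroup Q}
    {b : Gal(Fs/F) → cliffordGroup Q} (hb : IsLocallyConstant b) (hba : ∀ s, IsLift Q (b s) (a s))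
    {y : Gal(Fs/F) → Gal(Fs/F) → Fˣ} (hy : ∀ s t, (b s).1 * (b t).1 =
      scalarUnits Q (Additive.ofMul (y s t)) * (b (s * t)).1)
    {z : Z2 (galUnits F Fs)}
    (hz : ∀ s t, z.1 (s, t) = Additive.ofMul (Units.map (algebraMap F Fs : F →* Fs) (y s t))) :
    IsConnecting (fun σ => orthogonalBaseChange Fs Q (a σ)) (H2.mk z) := by
  obtain ⟨e, he, heb, hel⟩ := exists_locallyConstant_lift_ext Fs hb hba
  refine isConnecting_iff.2 ⟨e, he, hel, z, rfl, fun σ τ => ?_⟩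
  have h1 : galCliffordUnits Q σ (cliffordExtUnits Q Fs (b τ).1) = cliffordExtUnits Q Fs (b τ).1 :=
    Units.ext (galClifford_cliffordExt σ _)
  rw [heb, heb, heb, h1, ← map_mul, hy, map_mul, cliffordExtUnits_scalarUnits, hz, toMul_ofMul]

/-- The heart of the proof: the same lifting b over F, with norms prescribed by the cocycle of ξ,
yields SW over k and HW over Fs. -/
theorem exists_invariants [IsSepClosure F Fs] [FiniteDimensional F V]
    (hQ : Q.polarBilin.Nondegenerate) (φ : Gal(Fs/F) →* orthogonalGroup Q)
    (hφ : IsOpen (φ.ker : Set Gal(Fs/F))) (k : Type*) [Field k] [IsAlgClosed k] [Algebra F k] :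
    ∃ (d : H1 Gal(Fs/F) (ZMod 2)) (y : H2 (1 : Gal(Fs/F) →* AddMonoid.End (ZMod 2))),
      IsStiefelWhitney _ (scalarExt k φ) (d, y) ∧
      IsHasseWitt Q (twistByRep φ) ⟨d, toBr F Fs y +
        (xi Fs ⟨fun σ => spinorNorm Q (φ σ), spinorNorm_comp_mem_H1 hQ φ hφ⟩ : Br F Fs)⟩ := by
  obtain ⟨d, hd⟩ := exists_degree_mem_H1 hQ φ hφ
  obtain ⟨n, p, r, zξ, hn, hr, hnη, hrn, hrp, hzp, hξ⟩ := exists_cocycle_xi k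
    (⟨fun σ => spinorNorm Q (φ σ), spinorNorm_comp_mem_H1 hQ φ hφ⟩ : H1 Gal(Fs/F) (SqClass F))
  obtain ⟨b, hb, hbφ, hbn⟩ := exists_locallyConstant_normedLift hQ
    (isLocallyConstant_of_isOpen_ker φ hφ) hn hnη
  have hy : ∀ s t, ∃ y : Fˣ, (b s).1 * (b t).1 =
      scalarUnits Q (Additive.ofMul y) * (b (s * t)).1 := fun s t => by
    have h1 := (hbφ s).mul (hbφ t)
    rw [← map_mul] at h1
    obtain ⟨m, hm⟩ := (hbφ (s * t)).exists_eq_scalarUnits_mul hQ h1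
    exact ⟨m.toMul, hm⟩
  choose y hy using hy
  obtain ⟨z, hz, hzy⟩ := exists_isSW2 hQ k φ hb hbφ hbn hy hr hrn hrp
  refine ⟨d, H2.mk z, ⟨fun s => (hd s).cliffordExt k, hz⟩, ?_⟩
  obtain ⟨m, hm⟩ := exists_twistByRep_isometryEquiv φ hφ
  refine ⟨m.symm, fun σ => ?_, ?_⟩
  · rw [invCocycle_twistByRep φ m hm]
    exact (hd σ).cliffordExt Fs
  · have hcoc : invCocycle m.symm = fun σ => orthogonalBaseChange Fs Q (φ σ) :=
      funext (invCocycle_twistByRep φ m hm)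
    obtain ⟨w, hw, hwz⟩ := H2.exists_map_mk_eq (sgn Fs) (ρ' := galUnits F Fs) (fun g i => by
      apply Additive.toMul.injective
      change _ = Units.map (g : Fs →* Fs) (sgn Fs i).toMul
      exact (map_sgn (g : Fs →+* Fs) i).symm) z
    have hwz' : toBr F Fs (H2.mk z) = H2.mk w := hwz
    rw [hcoc]
    change IsConnecting _ (toBr F Fs (H2.mk z) + _)
    rw [hwz', hξ, ← map_add]
    refine isConnecting_of_factorSet hb hbφ hy fun s t => ?_
    rw [AddSubgroup.coe_add, Pi.add_apply, hw, hzp, hzy, map_mul, map_sgn (algebraMap F Fs)]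
    rfl

theorem two_nsmul_H2_zmod {G : Type*} [Group G] [TopologicalSpace G]
    (y : H2 (1 : G →* AddMonoid.End (ZMod 2))) : 2 • y = 0 := by
  obtain ⟨z, rfl⟩ := H2.mk_surjective y
  have : 2 • z = 0 := Subtype.ext (funext fun p => two_nsmul_zmod (z.1 p))
  rw [← map_nsmul, this, map_zero]

end Comparison

end FrohlichTheory

/-! ### The comparison theorem -/

open FrohlichTheory in
theorem mainTheorem3 {F : Type*} [Field F] {Fs : Type*} [Field Fs] [Algebra F Fs]
    [IsSepClosure F Fs] {V : Type*} [AddCommGroup V] [Module F V] [FiniteDimensional F V]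
    (Q : QuadraticForm F V) (hQ : Q.polarBilin.Nondegenerate)
    (φ : Gal(Fs/F) →* orthogonalGroup Q) (hφ : IsOpen (φ.ker : Set Gal(Fs/F)))
    (k : Type*) [Field k] [IsAlgClosed k] [Algebra F k] :
    (∀ g, ∃! c, IsSpinorNorm Q g c) ∧
    (∃! c, IsStiefelWhitney _ (scalarExt k φ) c) ∧
    (∃! h : BrS F Fs, IsHasseWitt (twistByRep φ) Q h) ∧
    swBar k φ ∈ BrS.two ∧ hasseWitt Fs (twistByRep φ) Q ∈ BrS.two ∧
    ∃ hδ : (fun σ => spinorNorm Q (φ σ)) ∈ H1 Gal(Fs/F) (SqClass F),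
      swBar k φ - hasseWitt Fs (twistByRep φ) Q =
        BrS.ofBr (xi Fs ⟨fun σ => spinorNorm Q (φ σ), hδ⟩ : Br F Fs) := by
  have : IsGalois F Fs := IsSepClosure.isGalois
  have hFs := baseChange_nondegenerate Fs hQ
  have hk := baseChange_nondegenerate k hQ
  have := finiteDimensional_twistByRep φ hφ
  obtain ⟨d, y, hSW, hHW⟩ := exists_invariants hQ φ hφ k
  obtain ⟨m, -⟩ := exists_twistByRep_isometryEquiv φ hφ
  -- Nondegeneracy is carried across the isometry m, so that the twist can serve as base space of a
  -- relative invariant.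
  have hφFs : (baseChange Fs (twistByRep φ)).polarBilin.Nondegenerate := by
    rw [nondegenerate_polarBilin_iff] at hFs ⊢
    have hm : ∀ x, baseChange Fs Q (m.toLinearEquiv x) = baseChange Fs (twistByRep φ) x := m.map_app
    intro v hv
    rw [← m.toLinearEquiv.map_eq_zero_iff]
    refine hFs _ fun w => ?_
    rw [← m.toLinearEquiv.apply_symm_apply w, ← hv (m.toLinearEquiv.symm w), QuadraticMap.polar,
      ← map_add, hm, hm, hm, QuadraticMap.polar]
  have hxi2 : ∀ η : H1 Gal(Fs/F) (SqClass F), 2 • (xi Fs η : Br F Fs) = 0 := fun η => (xi Fs η).2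
  have hto2 : 2 • toBr F Fs y = 0 := by rw [← map_nsmul, two_nsmul_H2_zmod, map_zero]
  -- The invariants are defined by `Classical.epsilon`; uniqueness identifies them with the explicit
  -- values just constructed.
  have hsw : swBar k φ = ⟨d, toBr F Fs y⟩ := by
    have h1 : stiefelWhitney _ (scalarExt k φ) = (d, y) :=
      hSW.unique hk (Classical.epsilon_spec ⟨_, hSW⟩)
    rw [swBar, h1]
  have hδ := spinorNorm_comp_mem_H1 hQ φ hφ
  have hhw : hasseWitt Fs (twistByRep φ) Q = ⟨d, toBr F Fs y +
      (xi Fs ⟨fun σ => spinorNorm Q (φ σ), hδ⟩ : Br F Fs)⟩ :=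
    hHW.unique hFs (Classical.epsilon_spec ⟨_, hHW⟩)
  refine ⟨existsUnique_isSpinorNorm hQ, ⟨_, hSW, fun c hc => hSW.unique hk hc⟩, ?_, ?_, ?_, hδ, ?_⟩
  -- The first explicit argument of `IsHasseWitt` is the base space, so this clause has base Q_φ and
  -- uses isometries to Q. By contrast `hasseWitt Fs (twistByRep φ) Q` unfolds to `IsHasseWitt Q
  -- (twistByRep φ)`, with base Q, whose existence and uniqueness are `hHW` and
  -- `IsHasseWitt.unique`.
  · obtain ⟨h, hh⟩ := exists_isHasseWitt hφFs m
    exact ⟨h, hh, fun h' hh' => hh.unique hφFs hh'⟩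
  · rw [hsw]; exact hto2
  · rw [hhw]
    change 2 • (_ + _) = 0
    rw [nsmul_add, hto2, hxi2, add_zero]
  · rw [hsw, hhw, sub_eq_iff_eq_add]
    apply BrS.ext
    · exact (zero_add d).symm
    -- In the graded law the correction term is a cup product with 0, and the two copies of ξ(δ∘φ)
    -- cancel because 2ξ = 0.
    · have hX := hxi2 ⟨fun σ => spinorNorm Q (φ σ), hδ⟩
      change toBr F Fs y = (xi Fs ⟨fun σ => spinorNorm Q (φ σ), hδ⟩ : Br F Fs) +
        (toBr F Fs y + (xi Fs ⟨fun σ => spinorNorm Q (φ σ), hδ⟩ : Br F Fs)) + toBr F Fs (cup 0 d)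
      rw [map_zero, AddMonoidHom.zero_apply, map_zero, add_zero, add_left_comm, ← two_nsmul, hX,
        add_zero]
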